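/- Let $T=(\mathbb C^*)^d$ with character lattice $\Lambda\cong\mathbb Z^d$, let $E$ be a finite totally ordered set, let $\chi_i\in\Lambda$ ($i\in E$) be primitive characters, and let $H_i=\{x\in T: e^{\chi_i}(x)=1\}$ be the hypertori of the associated central toric arrangement $\mathcal A$, with complement $M(\mathcal A)=T\setminus\bigcup_i H_i$. Assume that $\mathcal A$ is essential (the minimal connected components, under inclusion, of intersections of the $H_i$ are points). *Notation.* For $A\subseteq E$ let $\Lambda_A=\langle\chi_i: i\in A\rangle_{\mathbb Z}$, $\Lambda^A=(\mathbb Q\otimes\Lambda_A)\cap\Lambda$ and $m(A)=[\Lambda^A:\Lambda_A]$. Put $\psi_i=\frac1{2\pi\sqrt{-1}}\,d\log e^{\chi_i}$, and let $\psi_B$ be the product of the $\psi_i$, $i\in B$, in increasing order. For disjoint $A,B\subseteq E$ let $\ell(A,B)=\#\{(a,b)\in A\times B: b<a\}$. Let $f:U\to T$ be a finite covering by a torus. Let $a_i$ be the number of connected components of $f^{-1}(H_i)$, let $H_i^U(q)$ be the component containing $q$, let $\widehat\chi_i=\chi_i\circ f$, and put $$\overline\omega_i^U(q)=\tfrac{1}{2\pi\sqrt{-1}}\Bigl(2\,d\log\bigl(1-e^{\widehat\chi_i/a_i-(\widehat\chi_i/a_i)(q)}\bigr)-d\log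 e^{\widehat\chi_i/a_i}\Bigr),$$ and let $\overline\omega^U_A(q)$ be the product of the $\overline\omega_i^U(q)$, $i\in A$, in increasing order. The covering $f$ separates an independent set $A$ (i.e. $(\chi_i)_{i\in A}$ linearly independent) if for every connected component $W$ of $\bigcap_{i\in A}H_i$ there are $q_i\in f^{-1}(H_i)$ ($i\in A$) with $f\bigl(\bigcap_{i\in A}H^U_i(q_i)\bigr)=W$. (The intersection over $A=\emptyset$ is $T$, respectively $U$.) For $A$ independent and $W$ a connected component of $\bigcap_{i\in A}H_i$, let $\overline\omega_{W,A}$ be the unique form on $M(\mathcal A)$ with $$f^*\overline\omega_{W,A}=\frac{1}{\bigl|\bigcap_{i\in A}H_i^U(q_0)\cap f^{-1}(p)\bigr|}\sum_{q\in f^{-1}(p)}\overline\omega^U_A(q)\qquad(p\in W,\ q_0\in f^{-1}(p)),$$ where $f$ is any finite covering that separates $A$; it does not depend on the choices. Finally put $\overline\eta_{W,A,B}=(-1)^{\ell(A,B)}\,\overline\omega_{W,A}\,\psi_B$. **Theorem.** Suppose that the matroid of $(\chi_i)_{i\in E}$ has exactly one circuit $C$ (minimal linearly dependent index set), put $F=E\setminus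 C$, let $\sum_{i\in C}n_i\chi_i=0$ be a nontrivial integer relation, and set $c_i=\operatorname{sgn}(n_i)\in\{\pm1\}$ and $c_B=\prod_{i\in B}c_i$. Then for every connected component $L$ of $\bigcap_{i\in E}H_i$, $$\sum_{j\in C}\ \sum_{\substack{A,B\subseteq E\\ A\supseteq F\\ E=A\sqcup B\sqcup\{j\}\\ |B|\text{ even}\\ W\supseteq L}}(-1)^{|A_{\le j}|}\,c_B\,\frac{m(A)}{m(A\cup B)}\,\overline\eta_{W,A,B}=0$$ as an identity of differential forms on $M(\mathcal A)$, where $A_{\le j}=\{a\in A: a\le j\}$ and $W$ runs over the connected components of $\bigcap_{i\in A}H_i$ that contain $L$. -/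

import Mathlib

open scoped Matrix

noncomputable section

namespace ToricArr

/-! ### The torus, its characters and monomial coverings -/

/-- The complex torus `T = (ℂ^*)^d`, as an open subset of `ℂ^d`. -/
def torus (d : ℕ) : Set (Fin d → ℂ) := {x | ∀ k, x k ≠ 0}

/-- The character `e^ξ` of the torus attached to `ξ` in the character lattice `Λ = ℤ^d`:
`e^ξ (x) = ∏ k, x_k ^ ξ_k`. -/
def chr {d : ℕ} (ξ : Fin d → ℤ) (x : Fin d → ℂ) : ℂ := ∏ k, x k ^ ξ k

/-- An element of the lattice `ℤ^d` is primitive if it is not a proper multiple of another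
one (in particular it is nonzero, since `0 = 0 • w`). -/
def IsPrimitive {d : ℕ} (ξ : Fin d → ℤ) : Prop :=
  ∀ (m : ℤ) (w : Fin d → ℤ), ξ = m • w → IsUnit m

/-- The connected components of a subset of `ℂ^d`. -/
def IsComponent {d : ℕ} (S W : Set (Fin d → ℂ)) : Prop :=
  ∃ x ∈ S, W = connectedComponentIn S x

/-- The finite coverings `U → T` by tori. A lattice `Λ' ⊇ Λ = ℤ^d` of the same rank has a basis,
in which the inclusion `Λ ⊆ Λ'` is the map `ξ ↦ ξ ᵥ* P` for an integer matrix `P` of nonzero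
determinant; this identifies `U` with `(ℂ^*)^d` and the covering with the monomial map below. -/
def cover {d : ℕ} (P : Matrix (Fin d) (Fin d) ℤ) (u : Fin d → ℂ) : Fin d → ℂ :=
  fun k => chr (P k) u

/-- The fibre of the covering over the point `p`. -/
def fiber {d : ℕ} (P : Matrix (Fin d) (Fin d) ℤ) (p : Fin d → ℂ) : Set (Fin d → ℂ) :=
  {q | q ∈ torus d ∧ cover P q = p}

/-! ### Differential forms -/

/-- The exterior algebra of the (holomorphic) cotangent space of the torus at any point. -/
abbrev CoAlg (d : ℕ) : Type := ExteriorAlgebra ℂ (Module.Dual ℂ (Fin d → ℂ))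

/-- Complex differential forms of type `(p, 0)` on an open subset `X` of `ℂ^d`, as sections of
the exterior algebra of the cotangent bundle, with the pointwise wedge product. (No regularity
is required of a section; all forms constructed below are rational.) -/
abbrev DForm {d : ℕ} (X : Set (Fin d → ℂ)) : Type := X → CoAlg d

/-- The value at `x` of the logarithmic differential `d log g = dg / g`. -/
def dlog {d : ℕ} (g : (Fin d → ℂ) → ℂ) (x : Fin d → ℂ) : CoAlg d :=
  (g x)⁻¹ • ExteriorAlgebra.ι ℂ (fderiv ℂ g x : (Fin d → ℂ) →ₗ[ℂ] ℂ)

/-- `1 / (2 π √-1) · d log e^ξ`. -/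
def psiOne {d : ℕ} (ξ : Fin d → ℤ) (x : Fin d → ℂ) : CoAlg d :=
  (2 * (Real.pi : ℂ) * Complex.I)⁻¹ • dlog (chr ξ) x

/-- `1 / (2 π √-1) · d log (1 - e^{ξ - ξ(q)})`. -/
def omegaOne {d : ℕ} (ξ : Fin d → ℤ) (q x : Fin d → ℂ) : CoAlg d :=
  (2 * (Real.pi : ℂ) * Complex.I)⁻¹ • dlog (fun y => 1 - chr ξ y / chr ξ q) x

/-- The symmetrised form `2 ω - ψ`. -/
def omegaBarOne {d : ℕ} (ξ : Fin d → ℤ) (q x : Fin d → ℂ) : CoAlg d :=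
  (2 : ℂ) • omegaOne ξ q x - psiOne ξ x

/-- The product of the `g i`, `i ∈ A`, taken in increasing order of the index. -/
def orderedProd {E R : Type*} [LinearOrder E] [Monoid R] (A : Finset E) (g : E → R) : R :=
  ((A.sort (· ≤ ·)).map g).prod

/-- For disjoint `A`, `B`: the length (number of inversions) of the permutation that sorts the
concatenation of the increasing sequences `A` and `B`. -/
def ell {E : Type*} [LinearOrder E] (A B : Finset E) : ℕ :=
  ((A ×ˢ B).filter (fun ab => ab.2 < ab.1)).card

/-! ### Central toric arrangements -/

section Arrangement

variable {E : Type*} {d : ℕ} (χ : E → Fin d → ℤ)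

/-- The hypertorus `H_i = {x ∈ T | e^{χ_i} (x) = 1}`. -/
def hyp (i : E) : Set (Fin d → ℂ) := {x | x ∈ torus d ∧ chr (χ i) x = 1}

/-- The intersection `⋂_{i ∈ A} H_i` in `T` (equal to `T` for `A = ∅`). -/
def hypInter (A : Finset E) : Set (Fin d → ℂ) := torus d ∩ ⋂ i ∈ A, hyp χ i

/-- The complement `M(𝒜)` of the arrangement. -/
def arrCompl : Set (Fin d → ℂ) := torus d \ ⋃ i, hyp χ i

/-- The layers: the connected components of intersections of elements of the arrangement. -/
def layers : Set (Set (Fin d → ℂ)) := {W | ∃ A : Finset E, IsComponent (hypInter χ A) W}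

/-- The arrangement is essential if the maximal layers, for reverse inclusion, are points. -/
def IsEssential : Prop := ∀ W, Minimal (· ∈ layers χ) W → ∃ p, W = {p}

/-- The characters as elements of `ℚ ⊗ Λ = ℚ^d`. -/
def ratChar (i : E) : Fin d → ℚ := fun k => (χ i k : ℚ)

/-- The circuits: the minimal index sets of linearly dependent families of characters. -/
def IsCircuit (C : Finset E) : Prop :=
  Minimal (fun S : Finset E => ¬ LinearIndepOn ℚ (ratChar χ) (S : Set E)) C

/-- `Λ_A`, the subgroup of `Λ` spanned by the `χ_i`, `i ∈ A`. -/
def latSpan (A : Finset E) : AddSubgroup (Fin d → ℤ) := AddSubgroup.closure (χ '' (A : Set E))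

/-- `Λ^A = (ℚ ⊗ Λ_A) ∩ Λ`. -/
def latSat (A : Finset E) : AddSubgroup (Fin d → ℤ) :=
  ((Submodule.span ℚ (ratChar χ '' (A : Set E))).toAddSubgroup).comap
    ((Int.castAddHom ℚ).compLeft (Fin d))

/-- The multiplicity `m(A) = [Λ^A : Λ_A]`. -/
def mult (A : Finset E) : ℕ := (latSpan χ A).relIndex (latSat χ A)

/-! ### The lift of the arrangement to a covering -/

variable (P : Matrix (Fin d) (Fin d) ℤ)

/-- The preimage of `H_i` in the covering torus. -/
def preHyp (i : E) : Set (Fin d → ℂ) := torus d ∩ cover P ⁻¹' hyp χ i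

/-- `a_i`, the number of connected components of the preimage of `H_i`. -/
def numComp (i : E) : ℕ := {W | IsComponent (preHyp χ P i) W}.ncard

/-- The connected component `H_i^U(q)` of the preimage of `H_i` that contains `q`. -/
def liftHyp (i : E) (q : Fin d → ℂ) : Set (Fin d → ℂ) := connectedComponentIn (preHyp χ P i) q

/-- The character `χ̂_i / a_i` of the covering torus, where `χ̂_i = χ_i ᵥ* P` is the character
`χ_i ∘ f`; its entries are divisible by `a_i`. -/
def liftChar (i : E) : Fin d → ℤ := fun l => (χ i ᵥ* P) l / (numComp χ P i : ℤ)

/-- The complement of the lifted arrangement, i.e. the preimage of `M(𝒜)`. -/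
def liftCompl : Set (Fin d → ℂ) := torus d ∩ cover P ⁻¹' arrCompl χ

/-- The covering separates `A`: each component `W` of `⋂_{i ∈ A} H_i` is the image of an
intersection of components of preimages of the `H_i`, `i ∈ A`. -/
def Separates (A : Finset E) : Prop :=
  ∀ W, IsComponent (hypInter χ A) W → ∃ q : E → Fin d → ℂ, (∀ i ∈ A, q i ∈ preHyp χ P i) ∧
    cover P '' (torus d ∩ ⋂ i ∈ A, liftHyp χ P i (q i)) = W

/-- Pull-back of differential forms along the covering. -/
def pullback (θ : DForm (arrCompl χ)) : DForm (liftCompl χ P) := fun u =>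
  ExteriorAlgebra.map
    (LinearMap.dualMap (fderiv ℂ (cover P) u : (Fin d → ℂ) →ₗ[ℂ] (Fin d → ℂ)))
    (θ ⟨cover P u, u.2.2⟩)

/-! ### The forms attached to layers -/

variable [LinearOrder E]

/-- `ψ_B`, the increasing product of the `ψ_i`, `i ∈ B`. -/
def psiProd (B : Finset E) : DForm (arrCompl χ) := fun x => orderedProd B (fun i => psiOne (χ i) x)

/-- `ω̄_A^U(q)`, the increasing product of the `ω̄_i^U(q)`, `i ∈ A`. -/
def liftOmegaBar (A : Finset E) (q : Fin d → ℂ) : DForm (liftCompl χ P) := fun u =>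
  orderedProd A (fun i => omegaBarOne (liftChar χ P i) q u)

/-- The defining property of the form `ω̄_{W,A}^f` on `M(𝒜)`, for the covering `f` of matrix `P`:
its pull-back is the normalised sum of the `ω̄_A^U(q)` over the fibre of any point of `W`. -/
def IsOmegaBarVia (A : Finset E) (W : Set (Fin d → ℂ)) (θ : DForm (arrCompl χ)) : Prop :=
  ∀ p ∈ W, ∀ q₀ ∈ fiber P p, pullback χ P θ =
    (((torus d ∩ ⋂ i ∈ A, liftHyp χ P i q₀) ∩ fiber P p).ncard : ℂ)⁻¹ •
      ∑ᶠ q ∈ fiber P p, liftOmegaBar χ P A q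

/-- The form `ω̄_{W,A}^f`: the unique form with the defining property above. -/
def omegaBarVia (A : Finset E) (W : Set (Fin d → ℂ)) : DForm (arrCompl χ) :=
  Classical.epsilon (IsOmegaBarVia χ P A W)

/-- The form `ω̄_{W,A}`: it is `ω̄_{W,A}^f` for any finite covering `f` that separates `A`. -/
def omegaBar (A : Finset E) (W : Set (Fin d → ℂ)) : DForm (arrCompl χ) :=
  omegaBarVia χ (Classical.epsilon fun Q : Matrix (Fin d) (Fin d) ℤ =>
    Q.det ≠ 0 ∧ Separates χ Q A) A W

/-- The form `η̄_{W,A,B} = (-1)^{ℓ(A,B)} ω̄_{W,A} ψ_B`. -/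
def etaBar (W : Set (Fin d → ℂ)) (A B : Finset E) : DForm (arrCompl χ) :=
  (-1 : ℂ) ^ ell A B • (omegaBar χ A W * psiProd χ B)

end Arrangement

end ToricArr

end

open ToricArr

noncomputable section

namespace ToricArr

/-! ### Ordered products of anticommuting elements -/

section OrderedProd

variable {E R : Type*} [LinearOrder E]

/-! All terms of the sum are multiples of one form, so the theorem reduces to an identity between
functions. With `cay y = (y + 1) / (y - 1)`, the form 2 d log(1 - y) - d log y equals `cay y` times
d log y (`omegaBarOne_eq`), so ω̄_{W,A} is a function times ψ_A. Write x = p e^X with p ∈ L.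
Parametrising the fibres of a separating covering by cocharacters v modulo a suitable R turns this
function into (m(A) R^d)⁻¹ ∑_v ∏_{i ∈ A} coth(z_i / 2), where z_i = (χ_i(X) + 2π√-1 χ_i(v)) / a_i
(`fiber_sum_eq`). The factor m(A)⁻¹ comes from a lattice count (`card_mul_prod_eq_mult`,
`index_range_evalHom`) and cancels the m(A) of the statement.

The a_i depend on the covering, hence on A, but the multiplication formula for coth
(`sum_cay_mul_pow`) shows that they may be replaced by multiples (`cothSum_refine`). So one family a
serves every A, and it can be chosen with a_i |n_i| = D constant on C (`exists_common_refinement`).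
Then c_i z_i is 1/D times the i-th term of the circuit relation, so ∑_{i ∈ C} c_i z_i = 0 for every
single v. With y_i = e^{c_i z_i} this says ∏ y_i = 1, and `cay y + 1 = y * (cay y - 1)` gives ∏ (c_i
coth(z_i / 2) + 1) = ∏ (c_i coth(z_i / 2) - 1). Expanding both sides, the terms omitting an odd
subset B of C sum to zero (`sum_odd_sign_cothProd_eq_zero`).

The statement has this shape in disguise. Since A ∪ B = E \ {j}, each η̄_{W,A,B} is a function times
ψ_{E \ j}. Up to a common factor, ψ_{E \ j} is ± n_j (`orderedProd_erase_relation`) and m(E \ j) is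
|n_j| (`exists_mult_eq`), so their quotient contributes ± c_j and c_B becomes c_{B ∪ j}. For a fixed
odd set B ∪ {j}, the remaining signs alternate in j and add up to 1 (`sum_partitions_eq_sum_odd`).
-/

theorem orderedProd_insert_of_lt [Monoid R] (g : E → R) {a : E} {S : Finset E}
    (h : ∀ b ∈ S, a < b) : orderedProd (insert a S) g = g a * orderedProd S g := by
  rw [orderedProd, Finset.sort_insert _ (fun b hb => (h b hb).le) (fun ha => lt_irrefl a (h a ha)),
    List.map_cons, List.prod_cons, orderedProd]

@[simp] theorem orderedProd_empty [Monoid R] (g : E → R) : orderedProd ∅ g = 1 := by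
  simp [orderedProd]

theorem map_orderedProd {R' F : Type*} [Monoid R] [Monoid R'] [FunLike F R R']
    [MonoidHomClass F R R'] (f : F) (A : Finset E) (g : E → R) :
    f (orderedProd A g) = orderedProd A (fun i => f (g i)) := by
  rw [orderedProd, map_list_prod, List.map_map]
  rfl

theorem orderedProd_congr [Monoid R] {A : Finset E} {g g' : E → R} (h : ∀ i ∈ A, g i = g' i) :
    orderedProd A g = orderedProd A g' := by
  unfold orderedProd
  congr 1
  exact List.map_congr_left fun i hi => h i (by simpa using hi)

theorem orderedProd_smul {K : Type*} [CommRing K] [Ring R] [Algebra K R] (c : E → K) (g : E → R)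
    (A : Finset E) :
    orderedProd A (fun i => c i • g i) = (∏ i ∈ A, c i) • orderedProd A g := by
  induction A using Finset.induction_on_min with
  | empty => simp
  | insert a S h ih =>
    have ha : a ∉ S := fun ha => lt_irrefl a (h a ha)
    rw [orderedProd_insert_of_lt _ h, orderedProd_insert_of_lt _ h, ih, Finset.prod_insert ha,
      smul_mul_smul_comm]

/-- The sign records the transpositions that carry the new factor past the smaller ones. -/
theorem orderedProd_insert [Ring R] {g : E → R} (hg : ∀ i k, g i * g k = -(g k * g i))
    {i : E} {S : Finset E} (hi : i ∉ S) :
    orderedProd (insert i S) g =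
      (-1) ^ (S.filter (· < i)).card * (g i * orderedProd S g) := by
  induction S using Finset.induction_on_min with
  | empty => rw [orderedProd_insert_of_lt _ (by simp)]; simp
  | insert a S h ih =>
    have ha : a ∉ S := fun ha => lt_irrefl a (h a ha)
    rw [Finset.mem_insert, not_or] at hi
    rcases lt_or_gt_of_ne hi.1 with hia | hai
    · have hlt : ∀ b ∈ insert a S, i < b := by
        intro b hb
        rcases Finset.mem_insert.1 hb with rfl | hb
        · exact hia
        · exact hia.trans (h b hb)
      rw [orderedProd_insert_of_lt _ hlt,
        Finset.filter_false_of_mem fun b hb => not_lt.2 (hlt b hb).le]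
      simp
    · have hlt : ∀ b ∈ insert i S, a < b := by
        intro b hb
        rcases Finset.mem_insert.1 hb with rfl | hb
        · exact hai
        · exact h b hb
      rw [Finset.insert_comm, orderedProd_insert_of_lt _ hlt, ih hi.2, orderedProd_insert_of_lt _ h,
        Finset.filter_insert, if_pos hai, Finset.card_insert_of_notMem (by simp [ha]), pow_succ]
      have hc : ∀ x : R, x * (-1) ^ (S.filter (· < i)).card = (-1) ^ (S.filter (· < i)).card * x :=
        fun x => ((Commute.neg_one_right x).pow_right _).eq
      rw [← mul_assoc (g a), hc, ← mul_assoc (g i), hg i a]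
      simp only [mul_assoc, mul_neg, neg_mul, one_mul, neg_neg]

theorem mul_orderedProd_of_mem [Ring R] {g : E → R} (hg : ∀ i k, g i * g k = -(g k * g i))
    (hg0 : ∀ i, g i * g i = 0) {i : E} {S : Finset E} (hi : i ∈ S) :
    g i * orderedProd S g = 0 := by
  rw [← Finset.insert_erase hi, orderedProd_insert hg (Finset.notMem_erase i S), ← mul_assoc,
    ((Commute.neg_one_right (g i)).pow_right _).eq, mul_assoc, ← mul_assoc (g i), hg0, zero_mul,
    mul_zero]

theorem ell_insert {A B : Finset E} {a : E} (ha : a ∉ A) :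
    ell (insert a A) B = ell A B + (B.filter (· < a)).card := by
  unfold ell
  simp only [Finset.card_filter, Finset.sum_product]
  rw [Finset.sum_insert ha, add_comm]

/-- The sign in η̄ is exactly the one that sorts ψ_A ψ_B into ψ_{A ∪ B}. The induction removes the
least element of A, which passes only the smaller elements of B. -/
theorem neg_one_pow_ell_mul [Ring R] {g : E → R} (hg : ∀ i k, g i * g k = -(g k * g i))
    {A B : Finset E} (h : Disjoint A B) :
    (-1) ^ ell A B * (orderedProd A g * orderedProd B g) = orderedProd (A ∪ B) g := by
  induction A using Finset.induction_on_min with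
  | empty => simp [ell]
  | insert a S hS ih =>
    have ha : a ∉ S := fun ha => lt_irrefl a (hS a ha)
    rw [Finset.disjoint_insert_left] at h
    have hn : a ∉ S ∪ B := by simp [ha, h.1]
    rw [Finset.insert_union, orderedProd_insert hg hn, ← ih h.2, orderedProd_insert_of_lt _ hS,
      ell_insert ha, Finset.filter_union,
      Finset.filter_false_of_mem fun b hb => not_lt.2 (hS b hb).le, Finset.empty_union, pow_add]
    have hc : g a * (-1) ^ ell S B = (-1) ^ ell S B * g a :=
      ((Commute.neg_one_right (g a)).pow_right _).eq
    have hc' : ((-1 : R) ^ ell S B) * (-1) ^ (B.filter (· < a)).card =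
      (-1) ^ (B.filter (· < a)).card * (-1) ^ ell S B := by rw [← pow_add, add_comm, pow_add]
    rw [hc', ← mul_assoc (g a), hc]
    simp only [mul_assoc]

/-- In a family with one linear relation, the products that omit one factor of the relation are
proportional, with the coefficients of the relation as factors. -/
theorem orderedProd_erase_relation [Fintype E] {K : Type*} [Field K] [Ring R] [Algebra K R]
    {g : E → R} (hg : ∀ i k, g i * g k = -(g k * g i)) (hg0 : ∀ i, g i * g i = 0)
    {C : Finset E} {n : E → K} (hn : ∑ i ∈ C, n i • g i = 0) {j k : E} (hj : j ∈ C) (hk : k ∈ C) :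
    (n j * (-1) ^ (Finset.univ.filter (· < j)).card) • orderedProd (Finset.univ \ {k}) g =
      (n k * (-1) ^ (Finset.univ.filter (· < k)).card) • orderedProd (Finset.univ \ {j}) g := by
  wlog hjk : j < k generalizing j k
  · rcases eq_or_lt_of_le (not_lt.1 hjk) with rfl | h
    · rfl
    · exact (this hk hj h).symm
  set S : Finset E := Finset.univ \ {j, k} with hS
  have hsj : insert j S = Finset.univ \ {k} := by
    ext x; by_cases hx : x = j <;> simp [hS, hx, hjk.ne]
  have hsk : insert k S = Finset.univ \ {j} := by
    ext x; by_cases hx : x = k <;> simp [hS, hx, hjk.ne']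
  have hjS : j ∉ S := by simp [hS]
  have hkS : k ∉ S := by simp [hS]
  -- Multiplying the relation by the product over S = E \ {j, k} kills every term except those of j
  -- and k.
  have h0 : n j • (g j * orderedProd S g) + n k • (g k * orderedProd S g) = 0 := by
    have := congrArg (· * orderedProd S g) hn
    simp only [Finset.sum_mul, zero_mul, smul_mul_assoc] at this
    rwa [← Finset.sum_subset (s₁ := {j, k}), Finset.sum_pair hjk.ne] at this
    · intro x hx
      rcases Finset.mem_insert.1 hx with rfl | hx
      · exact hj
      · rwa [Finset.mem_singleton.1 hx]
    · intro x _ hx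
      rw [mul_orderedProd_of_mem hg hg0 (by simpa [hS] using hx), smul_zero]
  have e1 : (S.filter (· < j)) = Finset.univ.filter (· < j) := by
    ext x
    simp only [hS, Finset.mem_filter, Finset.mem_sdiff, Finset.mem_univ, true_and,
      Finset.mem_insert, Finset.mem_singleton, and_iff_right_iff_imp, not_or]
    exact fun h => ⟨h.ne, (h.trans hjk).ne⟩
  -- As j < k, the element j is counted below k in E but not in S; this shift by one cancels the
  -- minus sign coming from `h0`.
  have e2 : (Finset.univ.filter (· < k)).card = (S.filter (· < k)).card + 1 := by
    rw [← Finset.card_insert_of_notMem (s := S.filter (· < k)) (a := j) (by simp [hjS])]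
    congr 1
    ext x
    by_cases hx : x = j
    · simp [hx, hjk]
    · simp only [hS, Finset.mem_filter, Finset.mem_sdiff, Finset.mem_univ, true_and,
        Finset.mem_insert, Finset.mem_singleton, hx, false_or]
      exact ⟨fun h => ⟨h.ne, h⟩, fun h => h.2⟩
  have hs : ∀ (m : ℕ) (x : R), ((-1 : R) ^ m) * x = ((-1 : K) ^ m) • x := by
    intro m x
    rcases Nat.even_or_odd m with h | h <;> simp [h.neg_one_pow]
  rw [← hsj, ← hsk, orderedProd_insert hg hjS, orderedProd_insert hg hkS, e1, e2, hs, hs,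
    smul_smul, smul_smul]
  set a := (-1 : K) ^ (Finset.univ.filter (· < j)).card
  set b := (-1 : K) ^ (S.filter (· < k)).card with hb
  have ha : a * a = 1 := by rw [← pow_add, ← two_mul, pow_mul]; simp
  have hb' : b * b = 1 := by rw [← pow_add, ← two_mul, pow_mul]; simp
  have l1 : n j * a * a = n j := by rw [mul_assoc, ha, mul_one]
  have l2 : n k * (-1) ^ ((S.filter (· < k)).card + 1) * b = -n k := by
    rw [pow_succ, ← hb]; linear_combination (-n k) * hb'
  rw [l1, l2, neg_smul]
  exact eq_neg_of_add_eq_zero_left h0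

/-! ### Alternating sums -/

/-- Along the increasing enumeration of B the summands are 1, -1, 1, …, so only the parity of |B|
matters. -/
theorem sum_neg_one_pow_card_filter_lt {K : Type*} [Ring K] (B : Finset E) :
    ∑ j ∈ B, (-1 : K) ^ (B.filter (· < j)).card = if Odd B.card then 1 else 0 := by
  induction B using Finset.induction_on_min with
  | empty => simp
  | insert a S h ih =>
    have ha : a ∉ S := fun ha => lt_irrefl a (h a ha)
    have h1 : ∀ j ∈ S, (-1 : K) ^ ((insert a S).filter (· < j)).card =
        -(-1 : K) ^ (S.filter (· < j)).card := by
      intro j hj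
      rw [Finset.filter_insert, if_pos (h j hj), Finset.card_insert_of_notMem (by simp [ha]),
        pow_succ, mul_neg, mul_one]
    rw [Finset.sum_insert ha, Finset.sum_congr rfl h1, Finset.sum_neg_distrib, ih,
      Finset.card_insert_of_notMem ha, Finset.filter_false_of_mem]
    · by_cases ho : Odd S.card
      · simp [ho, Nat.odd_add_one]
      · simp [ho, Nat.odd_add_one]
    · intro b hb
      rcases Finset.mem_insert.1 hb with rfl | hb
      · exact lt_irrefl _
      · exact not_lt.2 (h b hb).le

/-- A triple (j, A, B) amounts to an odd set B ∪ {j} = E \ A ⊆ C with a marked element j. The two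
signs multiply to (-1) to the number of elements of E \ A below j, and summing over the marked
element gives 1. -/
theorem sum_partitions_eq_sum_odd [Fintype E] {K : Type*} [CommRing K] (C : Finset E)
    (Φ : Finset E → K) :
    ∑ j ∈ C,
      ∑ AB : Finset E × Finset E with
          (Finset.univ \ C ⊆ AB.1 ∧ Disjoint AB.1 AB.2 ∧ j ∉ AB.1 ∪ AB.2 ∧
            AB.1 ∪ AB.2 ∪ {j} = Finset.univ ∧ Even AB.2.card),
        (-1 : K) ^ (AB.1.filter (· ≤ j)).card * (-1) ^ (Finset.univ.filter (· < j)).card * Φ AB.1 =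
    ∑ B ∈ C.powerset with Odd B.card, Φ (Finset.univ \ B) := by
  have hR : ∀ B ∈ C.powerset.filter (fun B => Odd B.card), Φ (Finset.univ \ B) =
      ∑ j ∈ B, (-1 : K) ^ (B.filter (· < j)).card * Φ (Finset.univ \ B) := by
    intro B hB
    rw [← Finset.sum_mul, sum_neg_one_pow_card_filter_lt, if_pos (Finset.mem_filter.1 hB).2,
      one_mul]
  rw [Finset.sum_congr rfl hR, Finset.sum_sigma', Finset.sum_sigma']
  refine Finset.sum_bij' (fun x _ => ⟨Finset.univ \ x.2.1, x.1⟩)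
    (fun y _ => ⟨y.2, (Finset.univ \ y.1, y.1.erase y.2)⟩) ?_ ?_ ?_ ?_ ?_
  · rintro ⟨j, A, B⟩ hx
    simp only [Finset.mem_sigma, Finset.mem_filter, Finset.mem_univ, true_and,
      Finset.mem_powerset] at hx ⊢
    obtain ⟨hj, hF, hd, hjn, hu, he⟩ := hx
    have hB : Finset.univ \ A = insert j B := by
      ext x
      have := Finset.ext_iff.1 hu x
      have hd' : x ∈ A → x ∉ B := fun h => Finset.disjoint_left.1 hd h
      simp only [Finset.mem_union, Finset.mem_singleton, Finset.mem_univ, iff_true] at this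
      simp only [Finset.mem_sdiff, Finset.mem_univ, true_and, Finset.mem_insert]
      constructor
      · tauto
      · rintro (rfl | h)
        · exact fun h => hjn (Finset.mem_union_left _ h)
        · exact fun h' => hd' h' h
    have hjB : j ∉ B := fun h => hjn (Finset.mem_union_right _ h)
    refine ⟨⟨?_, ?_⟩, ?_⟩
    · intro x hx
      by_contra hxC
      exact (Finset.mem_sdiff.1 hx).2 (hF (by simpa using hxC))
    · rw [hB, Finset.card_insert_of_notMem hjB]
      exact he.add_one
    · simpa using fun h => hjn (Finset.mem_union_left _ h)
  · rintro ⟨B, j⟩ hy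
    simp only [Finset.mem_sigma, Finset.mem_filter, Finset.mem_univ, true_and,
      Finset.mem_powerset] at hy ⊢
    obtain ⟨⟨hB, ho⟩, hj⟩ := hy
    refine ⟨hB hj, Finset.sdiff_subset_sdiff le_rfl hB, ?_, ?_, ?_, ?_⟩
    · exact Finset.disjoint_of_subset_right (Finset.erase_subset _ _) Finset.sdiff_disjoint
    · simp [hj]
    · ext x
      by_cases hx : x = j <;> simp [hx, em']
    · rw [Finset.card_erase_of_mem hj]
      exact Nat.Odd.sub_odd ho odd_one
  · rintro ⟨j, A, B⟩ hx
    simp only [Finset.mem_sigma, Finset.mem_filter, Finset.mem_univ, true_and] at hx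
    obtain ⟨hj, hF, hd, hjn, hu, he⟩ := hx
    have hB : (Finset.univ \ A).erase j = B := by
      ext x
      have := Finset.ext_iff.1 hu x
      have hd' : x ∈ A → x ∉ B := fun h => Finset.disjoint_left.1 hd h
      simp only [Finset.mem_union, Finset.mem_singleton, Finset.mem_univ, iff_true] at this
      simp only [Finset.mem_sdiff, Finset.mem_univ, true_and, Finset.mem_erase]
      constructor
      · tauto
      · intro h
        exact ⟨fun e => hjn (Finset.mem_union_right _ (e ▸ h)), fun h' => hd' h' h⟩
    simp [hB]
  · rintro ⟨B, j⟩ hy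
    simp
  · rintro ⟨j, A, B⟩ hx
    simp only [Finset.mem_sigma, Finset.mem_filter, Finset.mem_univ, true_and] at hx
    obtain ⟨hj, hF, hd, hjn, hu, he⟩ := hx
    have e1 : A.filter (· ≤ j) = A.filter (· < j) := by
      refine Finset.filter_congr fun x hx => ⟨fun h => lt_of_le_of_ne h ?_, le_of_lt⟩
      rintro rfl
      exact hjn (Finset.mem_union_left _ hx)
    have e2 : (Finset.univ.filter (· < j)).card =
        (A.filter (· < j)).card + ((Finset.univ \ A).filter (· < j)).card := by
      rw [← Finset.card_union_of_disjoint
        (Finset.disjoint_filter_filter Finset.disjoint_sdiff), ← Finset.filter_union,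
        Finset.union_sdiff_of_subset (Finset.subset_univ A)]
    simp only [Finset.sdiff_sdiff_eq_self (Finset.subset_univ A), e1, e2, pow_add]
    rw [← mul_assoc, ← pow_add, ← two_mul, pow_mul]
    simp

end OrderedProd

/-- In the difference of the two expanded products the subset B has coefficient 1 - (-1)^|B|, which
is 2 for odd B and 0 otherwise. -/
theorem sum_odd_subsets_prod_eq_zero {E K : Type*} [DecidableEq E] [Field K] [CharZero K]
    {C : Finset E} {h : E → K} (hh : ∏ i ∈ C, (h i + 1) = ∏ i ∈ C, (h i - 1)) :
    ∑ B ∈ C.powerset with Odd B.card, ∏ i ∈ C \ B, h i = 0 := by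
  simp only [add_comm (h _) 1, sub_eq_neg_add] at hh
  rw [Finset.prod_add, Finset.prod_add, ← sub_eq_zero, ← Finset.sum_sub_distrib] at hh
  have h2 : (2 : K) * ∑ B ∈ C.powerset with Odd B.card, ∏ i ∈ C \ B, h i = 0 := by
    rw [← hh, Finset.mul_sum, Finset.sum_filter]
    refine Finset.sum_congr rfl fun B _ => ?_
    rcases Nat.even_or_odd B.card with ho | ho
    · simp [Nat.not_odd_iff_even.2 ho, ho.neg_one_pow]
    · simp only [ho, if_true, Finset.prod_const, ho.neg_one_pow]
      ring
  exact (mul_eq_zero.1 h2).resolve_left two_ne_zero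

/-! ### Lattice indices -/

theorem index_range_mulVecLin {ι : Type*} [Fintype ι] [DecidableEq ι] (T : Matrix ι ι ℤ)
    (hT : T.det ≠ 0) :
    (LinearMap.range T.mulVecLin).toAddSubgroup.index = T.det.natAbs := by
  have hinj : Function.Injective T.mulVecLin := by
    rw [Matrix.coe_mulVecLin]
    exact Matrix.mulVec_injective_of_det_ne_zero hT
  have h := Submodule.natAbs_det_equiv (LinearMap.range T.mulVecLin)
    (LinearEquiv.ofInjective T.mulVecLin hinj)
  have h2 : (LinearMap.range T.mulVecLin).subtype ∘ₗ
      ((LinearEquiv.ofInjective T.mulVecLin hinj) : (ι → ℤ) →+ LinearMap.range T.mulVecLin).toIntLinearMap = T.mulVecLin := by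
    ext; rfl
  rw [h2] at h
  rw [← Matrix.toLin'_apply', LinearMap.det_toLin'] at h
  exact h.symm

section

variable {E : Type*} {d : ℕ} {χ : E → Fin d → ℤ}

/-- Independence gives a rational left inverse of the combination map; b clears the denominators of
its matrix. -/
theorem exists_dual_family [DecidableEq E] {A : Finset E} (hA : LinearIndepOn ℚ (ratChar χ) (A : Set E)) :
    ∃ b : ℕ, 0 < b ∧ ∃ w : E → Fin d → ℤ, ∀ i ∈ A, ∀ k ∈ A,
      χ i ⬝ᵥ w k = if i = k then (b : ℤ) else 0 := by
  obtain ⟨g, hg⟩ := (Fintype.linearCombination ℚ (fun i : A => ratChar χ i)).exists_leftInverse_of_injective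
    (by
      rw [LinearMap.ker_eq_bot]
      exact hA.fintypeLinearCombination_injective)
  have hgi : ∀ i k : A, g (ratChar χ i) k = if i = k then 1 else 0 := by
    intro i k
    have := congrFun (LinearMap.congr_fun hg (Pi.single i 1)) k
    simp [Fintype.linearCombination_apply_single, Pi.single_apply] at this
    rw [this]
    simp [eq_comm]
  let b : ℕ := ∏ k : A, ∏ l : Fin d, (g (Pi.single l 1) k).den
  have hint : ∀ (k : A) (l : Fin d), ∃ z : ℤ, (z : ℚ) = b * g (Pi.single l 1) k := by
    intro k l
    have hd : (g (Pi.single l 1) k).den ∣ b :=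
      (Finset.dvd_prod_of_mem (fun l : Fin d => (g (Pi.single l 1) k).den) (Finset.mem_univ l)).trans
        (Finset.dvd_prod_of_mem (fun k : A => ∏ l : Fin d, (g (Pi.single l 1) k).den)
          (Finset.mem_univ k))
    obtain ⟨c, hc⟩ := hd
    refine ⟨c * (g (Pi.single l 1) k).num, ?_⟩
    rw [hc]
    push_cast
    conv_rhs => rw [mul_comm ((_ : ℕ) : ℚ), mul_assoc, Rat.den_mul_eq_num]
  choose z hz using hint
  refine ⟨b, Finset.prod_pos fun k _ => Finset.prod_pos fun l _ => Rat.den_pos _,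
    fun i => if h : i ∈ A then z ⟨i, h⟩ else 0, ?_⟩
  intro i hi k hk
  have h1 : g (ratChar χ i) ⟨k, hk⟩ = ∑ l, (χ i l : ℚ) * g (Pi.single l 1) ⟨k, hk⟩ := by
    conv_lhs => rw [← Finset.univ_sum_single (ratChar χ i)]
    rw [map_sum, Finset.sum_apply]
    refine Finset.sum_congr rfl fun l _ => ?_
    have : (Pi.single l (ratChar χ i l) : Fin d → ℚ) = ratChar χ i l • Pi.single l 1 := by
      ext m; simp [Pi.single_apply]
    rw [this, map_smul]
    rfl
  have h2 := hgi ⟨i, hi⟩ ⟨k, hk⟩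
  rw [h1] at h2
  have : ((χ i ⬝ᵥ z ⟨k, hk⟩ : ℤ) : ℚ) = b * (if i = k then 1 else 0) := by
    rw [dotProduct]
    push_cast
    simp only [hz]
    simp only [Subtype.mk.injEq] at h2
    rw [← h2, Finset.mul_sum]
    exact Finset.sum_congr rfl fun l _ => by ring
  simp only [hk, dif_pos]
  split_ifs at this ⊢
  · rw [mul_one] at this
    exact_mod_cast this
  · rw [mul_zero] at this
    exact_mod_cast this

theorem mem_latSat {A : Finset E} {v : Fin d → ℤ} :
    v ∈ latSat χ A ↔ (fun k => (v k : ℚ)) ∈ Submodule.span ℚ (ratChar χ '' (A : Set E)) :=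
  Iff.rfl

theorem latSpan_le_latSat (A : Finset E) : latSpan χ A ≤ latSat χ A := by
  rw [latSpan, AddSubgroup.closure_le]
  rintro _ ⟨i, hi, rfl⟩
  exact mem_latSat.2 (Submodule.subset_span ⟨i, hi, rfl⟩)

theorem exists_dotProduct_eq_sum [DecidableEq E] {A : Finset E} {v : Fin d → ℤ} (hv : v ∈ latSat χ A) :
    ∃ c : E → ℚ, ∀ w : Fin d → ℤ, ((v ⬝ᵥ w : ℤ) : ℚ) = ∑ i ∈ A, c i * (χ i ⬝ᵥ w : ℤ) := by
  rw [mem_latSat, Submodule.mem_span_image_finset_iff_exists_fun] at hv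
  obtain ⟨c, hc⟩ := hv
  refine ⟨fun i => if h : i ∈ A then c ⟨i, h⟩ else 0, fun w => ?_⟩
  have hk : ∀ k, (v k : ℚ) = ∑ i ∈ A, (if h : i ∈ A then c ⟨i, h⟩ else 0) * χ i k := by
    intro k
    have := congrFun hc k
    simp only [Finset.sum_apply, Pi.smul_apply, smul_eq_mul, ratChar] at this
    rw [← this, ← Finset.sum_coe_sort A]
    simp
  simp only [dotProduct]
  push_cast
  simp only [hk, Finset.sum_mul, Finset.mul_sum]
  rw [Finset.sum_comm]
  exact Finset.sum_congr rfl fun i _ => Finset.sum_congr rfl fun k _ => by ring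

theorem mem_latSat_of_smul_mem {A : Finset E} {v : Fin d → ℤ} {m : ℤ} (hm : m ≠ 0)
    (h : m • v ∈ latSat χ A) : v ∈ latSat χ A := by
  rw [mem_latSat] at h ⊢
  have : (fun k => (v k : ℚ)) = (m : ℚ)⁻¹ • (fun k => (((m • v) k : ℤ) : ℚ)) := by
    ext k
    have : (m : ℚ) ≠ 0 := by exact_mod_cast hm
    simp [this]
  rw [this]
  exact Submodule.smul_mem _ _ h

/-- A saturated sublattice is a direct summand, so its coordinate functions extend to ℤ^d and are
given by cocharacters. This is read off the Smith normal form: saturation forces all elementary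
divisors to be ±1. -/
theorem exists_basis_latSat [DecidableEq E] {A : Finset E} (hA : LinearIndepOn ℚ (ratChar χ) (A : Set E)) :
    ∃ (β : Module.Basis A ℤ (latSat χ A).toIntSubmodule) (w : A → Fin d → ℤ),
      ∀ i j, (β i : Fin d → ℤ) ⬝ᵥ w j = if i = j then 1 else 0 := by
  obtain ⟨b, hb, w, hw⟩ := exists_dual_family hA
  set N := (latSat χ A).toIntSubmodule with hN
  obtain ⟨m, S⟩ := Submodule.smithNormalForm (Pi.basisFun ℤ (Fin d)) N
  -- The rank is squeezed between two injections: pairing with the dual family, and the combinations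
  -- of the χ_i.
  have hm : m = A.card := by
    have h1 : Module.finrank ℤ N = m := by
      rw [Module.finrank_eq_card_basis S.bN, Fintype.card_fin]
    have h2 : Module.finrank ℤ (A → ℤ) = A.card := by simp
    rw [← h1, ← h2]
    apply le_antisymm
    · let φ : N →ₗ[ℤ] (A → ℤ) := LinearMap.pi fun k =>
        (dotProductBilin ℤ ℤ).flip (w k) ∘ₗ N.subtype
      refine LinearMap.finrank_le_finrank_of_injective (f := φ) ?_
      rw [← LinearMap.ker_eq_bot, LinearMap.ker_eq_bot']
      rintro ⟨v, hv⟩ h0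
      have h0' : ∀ k ∈ A, v ⬝ᵥ w k = 0 := fun k hk => congrFun h0 ⟨k, hk⟩
      obtain ⟨c, hc⟩ := exists_dotProduct_eq_sum hv
      have hck : ∀ k ∈ A, c k = 0 := by
        intro k hk
        have := hc (w k)
        rw [h0' k hk, Finset.sum_congr rfl fun i hi => by rw [hw i hi k hk]] at this
        simp [hk, hb.ne'] at this
        exact this
      ext l
      have := hc (Pi.single l 1)
      rw [Finset.sum_eq_zero fun i hi => by rw [hck i hi, zero_mul]] at this
      simpa using this
    · let φ : (A → ℤ) →ₗ[ℤ] N := Fintype.linearCombination ℤ fun i : A =>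
        (⟨χ i, latSpan_le_latSat A (AddSubgroup.subset_closure ⟨i, i.2, rfl⟩)⟩ : N)
      refine LinearMap.finrank_le_finrank_of_injective (f := φ) ?_
      rw [← LinearMap.ker_eq_bot, LinearMap.ker_eq_bot']
      intro c h0
      have h0' : ∑ i : A, c i • χ i = 0 := by
        have := congrArg N.subtype h0
        simpa [φ, Fintype.linearCombination_apply] using this
      ext k
      have := congrArg (· ⬝ᵥ w k) h0'
      simp only [sum_dotProduct, smul_dotProduct, zero_dotProduct] at this
      rw [Finset.sum_congr rfl fun i _ => by rw [hw i i.2 k k.2]] at this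
      simpa [Subtype.coe_inj, hb.ne'] using this
  subst hm
  have ha0 : ∀ i, S.a i ≠ 0 := by
    intro i h
    have h1 := S.snf i
    rw [h, zero_smul] at h1
    exact S.bN.ne_zero i (Subtype.ext h1)
  have hmem : ∀ i, S.bM (S.f i) ∈ latSat χ A := by
    intro i
    refine mem_latSat_of_smul_mem (ha0 i) ?_
    rw [← S.snf i]
    exact (S.bN i).2
  have hrepr : ∀ (v : N) (i), S.bM.repr (v : Fin d → ℤ) (S.f i) = S.a i * S.bN.repr v i := by
    intro v i
    rw [S.repr_apply_embedding_eq_repr_smul, map_smul, Finsupp.smul_apply, smul_eq_mul]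
  -- The ambient basis vector already lies in the saturation, so `S.a i` times its integral
  -- coordinate there equals 1.
  have haa : ∀ i, S.a i * S.a i = 1 := by
    intro i
    have h1 := hrepr ⟨S.bM (S.f i), hmem i⟩ i
    simp only [Module.Basis.repr_self, Finsupp.single_eq_same] at h1
    have h2 : IsUnit (S.a i) := IsUnit.of_mul_eq_one _ h1.symm
    rcases Int.isUnit_iff.1 h2 with h | h <;> rw [h] <;> rfl
  let e : Fin A.card ≃ A := A.equivFin.symm
  refine ⟨S.bN.reindex e, fun j k => S.a (e.symm j) *
    S.bM.repr (Pi.single k 1) (S.f (e.symm j)), fun i j => ?_⟩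
  have hdot : ∀ v : Fin d → ℤ, (v ⬝ᵥ fun k => S.a (e.symm j) *
      S.bM.repr (Pi.single k 1) (S.f (e.symm j))) =
      S.a (e.symm j) * S.bM.repr v (S.f (e.symm j)) := by
    intro v
    have hv : v = ∑ k, v k • (Pi.single k 1 : Fin d → ℤ) := by
      ext l; simp [Pi.single_apply]
    conv_rhs => rw [hv]
    rw [map_sum, Finsupp.finsetSum_apply, Finset.mul_sum, dotProduct]
    refine Finset.sum_congr rfl fun k _ => ?_
    rw [map_smul, Finsupp.smul_apply, smul_eq_mul]
    ring
  rw [hdot, hrepr, Module.Basis.reindex_apply, Module.Basis.repr_self, ← mul_assoc, haa, one_mul,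
    Finsupp.single_apply]
  simp

/-- Evaluation of the characters `χ_i`, `i ∈ A`, on the cocharacter lattice. -/
def evalHom (χ : E → Fin d → ℤ) (A : Finset E) : (Fin d → ℤ) →+ (A → ℤ) where
  toFun v := fun i => χ i ⬝ᵥ v
  map_zero' := by ext; simp
  map_add' v w := by ext; simp [dotProduct_add]

/-- Express χ_i = ∑ T_ij β_j in a basis β of Λ^A. The β_j map the cocharacters onto ℤ^A, so the
image of evaluation is T ℤ^A, while Λ_A has coordinate lattice Tᵀ ℤ^A. Both have index |det T|. -/
theorem index_range_evalHom [DecidableEq E] {A : Finset E}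
    (hA : LinearIndepOn ℚ (ratChar χ) (A : Set E)) :
    (evalHom χ A).range.index = mult χ A := by
  obtain ⟨b, hb, w, hw⟩ := exists_dual_family hA
  obtain ⟨β, w', hw'⟩ := exists_basis_latSat hA
  let x : A → (latSat χ A).toIntSubmodule := fun i =>
    ⟨χ i, latSpan_le_latSat A (AddSubgroup.subset_closure ⟨i, i.2, rfl⟩)⟩
  let T : Matrix A A ℤ := fun i j => β.repr (x i) j
  have hT : ∀ (i : A) v, χ (i : E) ⬝ᵥ v = ∑ j, T i j * ((β j : Fin d → ℤ) ⬝ᵥ v) := by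
    intro i v
    have h1 : (χ i : Fin d → ℤ) = ∑ j, T i j • (β j : Fin d → ℤ) := by
      have := congrArg (latSat χ A).toIntSubmodule.subtype (β.sum_repr (x i))
      rw [map_sum] at this
      exact this.symm
    rw [h1, sum_dotProduct]
    simp only [smul_dotProduct, smul_eq_mul]
  have hdet : T.det ≠ 0 := by
    have h1 : T * (Matrix.of fun j k : A => (β j : Fin d → ℤ) ⬝ᵥ w k) = (b : ℤ) • 1 := by
      ext i k
      rw [Matrix.mul_apply]
      simp only [Matrix.of_apply, Matrix.smul_apply, Matrix.one_apply, smul_eq_mul]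
      rw [← hT, hw i i.2 k k.2]
      simp
    intro h0
    have h2 := congrArg Matrix.det h1
    rw [Matrix.det_mul, h0, zero_mul, Matrix.det_smul, Matrix.det_one, mul_one] at h2
    exact pow_ne_zero _ (by exact_mod_cast hb.ne') h2.symm
  have e1 : (evalHom χ A).range = (LinearMap.range T.mulVecLin).toAddSubgroup := by
    ext y
    constructor
    · rintro ⟨v, rfl⟩
      exact ⟨fun j => (β j : Fin d → ℤ) ⬝ᵥ v, funext fun i => (hT i v).symm⟩
    · rintro ⟨c, rfl⟩
      refine ⟨∑ k, c k • w' k, funext fun i => ?_⟩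
      change χ i ⬝ᵥ _ = ∑ j, T i j * c j
      rw [hT]
      refine Finset.sum_congr rfl fun j _ => ?_
      simp only [dotProduct_sum, dotProduct_smul, hw', smul_eq_mul, mul_ite, mul_one, mul_zero,
        Finset.sum_ite_eq, Finset.mem_univ, if_true]
  let ε : latSat χ A ≃+ (A → ℤ) := β.equivFun.toAddEquiv
  have hcoe : ∀ c : A → ℤ, ((∑ i, c i • x i : (latSat χ A).toIntSubmodule) : Fin d → ℤ) =
      ∑ i : A, c i • χ i := by
    intro c
    exact map_sum (latSat χ A).toIntSubmodule.subtype _ _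
  have hε : ∀ c : A → ℤ, ε (∑ i, c i • x i : (latSat χ A).toIntSubmodule) = Tᵀ.mulVecLin c := by
    intro c
    ext j
    change β.repr (∑ i, c i • x i) j = ∑ i, T i j * c i
    rw [map_sum, Finsupp.finsetSum_apply]
    refine Finset.sum_congr rfl fun i _ => ?_
    rw [map_smul, Finsupp.smul_apply, smul_eq_mul, mul_comm]
  have e2 : ((latSpan χ A).addSubgroupOf (latSat χ A)).map
      (ε : (latSat χ A) →+ (A → ℤ)) =
      (LinearMap.range Tᵀ.mulVecLin).toAddSubgroup := by
    have hgen : latSpan χ A = AddSubgroup.closure (Set.range fun i : A => χ i) := by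
      rw [latSpan]
      congr 1
      ext; simp
    have hmem : ∀ y : Fin d → ℤ, y ∈ latSpan χ A ↔ ∃ c : A → ℤ, y = ∑ i, c i • χ i := by
      intro y
      rw [hgen, ← SetLike.mem_coe, ← AddSubgroup.coe_toIntSubmodule, SetLike.mem_coe,
        AddSubgroup.toIntSubmodule_closure,
        Submodule.mem_span_range_iff_exists_fun]
      simp only [eq_comm]
    ext y
    constructor
    · rintro ⟨v, hv, rfl⟩
      obtain ⟨c, hc⟩ := (hmem v).1 hv
      have hv' : v = (∑ i, c i • x i : (latSat χ A).toIntSubmodule) :=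
        Subtype.ext (hc.trans (hcoe c).symm)
      exact ⟨c, by rw [hv']; exact (hε c).symm⟩
    · rintro ⟨c, rfl⟩
      exact ⟨(∑ i, c i • x i : (latSat χ A).toIntSubmodule), (hmem _).2 ⟨c, hcoe c⟩, hε c⟩
  rw [e1, index_range_mulVecLin T hdet, mult, AddSubgroup.relIndex,
    ← AddSubgroup.index_map_equiv _ ε, ← Matrix.det_transpose T,
    ← index_range_mulVecLin Tᵀ (by rwa [Matrix.det_transpose]), ← e2]

end

/-! ### Counting cocharacters modulo `R` -/

section

variable {E : Type*} {d : ℕ} {χ : E → Fin d → ℤ}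

/-- The standard integral representatives of a vector modulo `R`. -/
def zlift {R : ℕ} (v : Fin d → ZMod R) : Fin d → ℤ := fun k => ((v k).cast : ℤ)

theorem intCast_zlift {R : ℕ} [NeZero R] (v : Fin d → ZMod R) (k : Fin d) :
    ((zlift v k : ℤ) : ZMod R) = v k := by
  simp [zlift]

/-- The set counted is the kernel of φ : (ℤ/R)^d → ∏ ℤ/a_i. By `hw` the image of evaluation contains
∏ a_i ℤ, so it is the full preimage of the range of φ, whose index is therefore m(A). -/
theorem card_mul_prod_eq_mult {A : Finset E} (hA : LinearIndepOn ℚ (ratChar χ) (A : Set E))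
    {a : E → ℕ} {R : ℕ} [NeZero R] (haR : ∀ i ∈ A, a i ∣ R)
    (hw : ∀ i ∈ A, ∃ w : Fin d → ℤ, χ i ⬝ᵥ w = a i ∧ ∀ k ∈ A, k ≠ i → χ k ⬝ᵥ w = 0) :
    Nat.card {v : Fin d → ZMod R // ∀ i ∈ A, (a i : ℤ) ∣ χ i ⬝ᵥ zlift v} * ∏ i ∈ A, a i =
      mult χ A * R ^ d := by
  classical
  have ha0 : ∀ i : A, NeZero (a i) := fun i => ⟨fun h => NeZero.ne R (by simpa [h] using haR i i.2)⟩
  let φ : (Fin d → ZMod R) →+ (∀ i : A, ZMod (a i)) :=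
    { toFun := fun v i => ∑ k, (χ i k : ZMod (a i)) * ZMod.castHom (haR i i.2) (ZMod (a i)) (v k)
      map_zero' := by ext; simp
      map_add' := fun v w => by
        ext
        simp only [Pi.add_apply, map_add, mul_add, Finset.sum_add_distrib] }
  have hφ : ∀ v i, φ v i = ((χ i ⬝ᵥ zlift v : ℤ) : ZMod (a i)) := by
    intro v i
    change ∑ k, (χ i k : ZMod (a i)) * ZMod.castHom (haR i i.2) (ZMod (a i)) (v k) = _
    rw [dotProduct]
    push_cast
    refine Finset.sum_congr rfl fun k _ => ?_
    conv_lhs => rw [← intCast_zlift v k]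
    rw [map_intCast]
  let π : (A → ℤ) →+ (∀ i : A, ZMod (a i)) :=
    { toFun := fun y i => (y i : ZMod (a i))
      map_zero' := by ext; simp
      map_add' := fun v w => by ext; simp }
  have hπ : Function.Surjective π := fun y =>
    ⟨fun i => ((y i).cast : ℤ), funext fun i => ZMod.intCast_zmod_cast (y i)⟩
  have hrange : φ.range.comap π = (evalHom χ A).range := by
    ext y
    constructor
    · rintro ⟨v, hv⟩
      have hdvd : ∀ i : A, (a i : ℤ) ∣ y i - χ i ⬝ᵥ zlift v := by
        intro i
        have := congrFun hv i
        rw [hφ] at this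
        rw [← ZMod.intCast_zmod_eq_zero_iff_dvd]
        push_cast
        rw [this, sub_eq_zero]
        rfl
      choose c hc using hdvd
      choose w hw1 hw2 using hw
      -- The values agree modulo the a_i; the cocharacters w_k correct them one coordinate at a
      -- time.
      refine ⟨zlift v + ∑ k : A, c k • w k k.2, funext fun i => ?_⟩
      change χ i ⬝ᵥ _ = y i
      rw [dotProduct_add, dotProduct_sum, Finset.sum_eq_single i]
      · rw [dotProduct_smul, hw1, smul_eq_mul, mul_comm, ← hc]
        ring
      · intro k _ hk
        rw [dotProduct_smul, hw2 k k.2 i i.2 (fun h => hk (Subtype.ext h.symm)), smul_zero]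
      · simp
    · rintro ⟨v, rfl⟩
      refine ⟨fun k => (v k : ZMod R), funext fun i => ?_⟩
      change ∑ k, (χ i k : ZMod (a i)) * ZMod.castHom (haR i i.2) (ZMod (a i)) (v k : ZMod R) =
        ((χ i ⬝ᵥ v : ℤ) : ZMod (a i))
      rw [dotProduct]
      push_cast
      simp only [map_intCast]
  have h1 : Nat.card φ.ker * Nat.card φ.range = R ^ d := by
    rw [← AddSubgroup.index_ker, AddSubgroup.card_mul_index]
    simp
  have h2 : Nat.card φ.range * mult χ A = ∏ i ∈ A, a i := by
    rw [← index_range_evalHom hA, ← hrange, AddSubgroup.index_comap_of_surjective _ hπ,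
      AddSubgroup.card_mul_index, Nat.card_pi, ← Finset.prod_coe_sort A]
    simp
  have h3 : Nat.card {v : Fin d → ZMod R // ∀ i ∈ A, (a i : ℤ) ∣ χ i ⬝ᵥ zlift v} =
      Nat.card φ.ker := by
    refine Nat.card_congr (Equiv.subtypeEquivRight fun v => ?_)
    rw [AddMonoidHom.mem_ker, funext_iff]
    simp only [hφ, Pi.zero_apply, ZMod.intCast_zmod_eq_zero_iff_dvd, Subtype.forall]
  rw [h3, ← h2, ← h1]
  ring

theorem mem_latSpan {A : Finset E} {y : Fin d → ℤ} :
    y ∈ latSpan χ A ↔ ∃ c : E → ℤ, ∑ i ∈ A, c i • χ i = y := by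
  classical
  rw [latSpan, ← SetLike.mem_coe, ← AddSubgroup.coe_toIntSubmodule, SetLike.mem_coe,
    AddSubgroup.toIntSubmodule_closure, Submodule.mem_span_image_finset_iff_exists_fun]
  constructor
  · rintro ⟨c, hc⟩
    refine ⟨fun i => if h : i ∈ A then c ⟨i, h⟩ else 0, ?_⟩
    rw [← hc, ← Finset.sum_coe_sort A]
    simp
  · rintro ⟨c, hc⟩
    refine ⟨fun i => c i, ?_⟩
    rw [← hc, ← Finset.sum_coe_sort A]

theorem eq_zero_of_sum_eq_zero {A : Finset E} (hA : LinearIndepOn ℚ (ratChar χ) (A : Set E))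
    {r : E → ℤ} (hr : ∑ i ∈ A, r i • χ i = 0) {i : E} (hi : i ∈ A) : r i = 0 := by
  have h := linearIndepOn_finset_iff.1 hA (fun i => (r i : ℚ)) (by
    ext k
    have := congrFun hr k
    simp only [Finset.sum_apply, Pi.smul_apply, Pi.zero_apply, ratChar, smul_eq_mul] at this ⊢
    exact_mod_cast this) i hi
  exact_mod_cast h

theorem linearIndepOn_of_notMem_circuit {C : Finset E} (hC : ∀ S : Finset E, IsCircuit χ S ↔ S = C)
    {A : Finset E} {j : E} (hj : j ∈ C) (hjA : j ∉ A) :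
    LinearIndepOn ℚ (ratChar χ) (A : Set E) := by
  by_contra h
  obtain ⟨S, hSA, hS⟩ := exists_minimal_le_of_wellFoundedLT
    (fun S : Finset E => ¬ LinearIndepOn ℚ (ratChar χ) (S : Set E)) A h
  rw [(hC S).1 hS] at hSA
  exact hjA (hSA hj)

/-! ### Lattice indices along the circuit -/

section Circuit

variable [DecidableEq E] {C : Finset E}

theorem coeff_ne_zero (hC : ∀ S : Finset E, IsCircuit χ S ↔ S = C) {n : E → ℤ}
    (hn : ∑ i ∈ C, n i • χ i = 0) (hn0 : ∃ i ∈ C, n i ≠ 0) {j : E} (hj : j ∈ C) : n j ≠ 0 := by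
  intro h0
  obtain ⟨i, hi, hi0⟩ := hn0
  have hA := linearIndepOn_of_notMem_circuit hC hj (Finset.notMem_erase j C)
  refine hi0 (eq_zero_of_sum_eq_zero hA (r := n) ?_ (Finset.mem_erase.2 ⟨?_, hi⟩))
  · rw [← hn, ← Finset.add_sum_erase C (fun i => n i • χ i) hj, h0, zero_smul, zero_add]
  · rintro rfl
    exact hi0 h0

variable [Fintype E]

/-- The quotient is cyclic, generated by χ_j. If k χ_j lies in the span of the others, independence
of E \ {j} makes k n an integral multiple of n_j in every coordinate, so n_j divides k gcd(n) = k.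
-/
theorem relIndex_latSpan_erase (hC : ∀ S : Finset E, IsCircuit χ S ↔ S = C) {n : E → ℤ}
    (hn : ∑ i ∈ C, n i • χ i = 0) (hn1 : C.gcd n = 1) {j : E} (hj : j ∈ C) :
    (latSpan χ (Finset.univ \ {j})).relIndex (latSpan χ Finset.univ) = (n j).natAbs := by
  set A := Finset.univ \ {j} with hAdef
  have hjA : j ∉ A := by simp [hAdef]
  have hins : insert j A = Finset.univ := by ext x; simp [hAdef]
  have hA := linearIndepOn_of_notMem_circuit hC hj hjA
  have hn0 : ∃ i ∈ C, n i ≠ 0 := by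
    by_contra! h
    rw [Finset.gcd_eq_zero_iff.2 h] at hn1
    exact zero_ne_one hn1
  have hnj := coeff_ne_zero hC hn hn0 hj
  let n' : E → ℤ := fun i => if i ∈ C then n i else 0
  have hn' : ∑ i ∈ A, n' i • χ i = -(n j • χ j) := by
    rw [eq_neg_iff_add_eq_zero, add_comm]
    have h1 : n j • χ j = n' j • χ j := by simp [n', hj]
    have h2 : n' j • χ j + ∑ i ∈ A, n' i • χ i = ∑ i ∈ insert j A, n' i • χ i :=
      (Finset.sum_insert (f := fun i => n' i • χ i) hjA).symm
    rw [h1, h2, hins, ← hn, ← Finset.sum_subset (Finset.subset_univ C)]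
    · exact Finset.sum_congr rfl fun i hi => by simp [n', hi]
    · intro i _ hi
      simp [n', hi]
  have hdvd : ∀ k : ℤ, k • χ j ∈ latSpan χ A ↔ n j ∣ k := by
    intro k
    constructor
    · rintro hk
      obtain ⟨c, hc⟩ := mem_latSpan.1 hk
      have hrel : ∀ i ∈ A, n j * c i + k * n' i = 0 := fun i hi => by
        refine eq_zero_of_sum_eq_zero hA (r := fun i => n j * c i + k * n' i) ?_ hi
        simp only [add_smul, mul_smul, Finset.sum_add_distrib, ← Finset.smul_sum, hc, hn']
        rw [smul_neg, smul_comm, add_neg_cancel]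
      -- The coefficients of k times the circuit relation are divisible by n_j one by one;
      -- primitivity then removes the factor gcd(n).
      have : n j ∣ C.gcd fun i => k * n i := by
        refine Finset.dvd_gcd fun i hi => ?_
        by_cases hij : i = j
        · rw [hij]; exact dvd_mul_left _ _
        · refine ⟨-c i, ?_⟩
          have := hrel i (by simpa [hAdef] using hij)
          simp only [n', hi, if_true] at this
          linarith
      rw [Finset.gcd_mul_left, hn1, mul_one] at this
      exact dvd_normalize_iff.1 this
    · rintro ⟨c, rfl⟩
      rw [mul_comm, mul_smul]
      refine AddSubgroup.zsmul_mem _ ?_ _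
      rw [← neg_mem_iff, ← hn']
      exact mem_latSpan.2 ⟨n', rfl⟩
  have hjmem : χ j ∈ latSpan χ Finset.univ := AddSubgroup.subset_closure ⟨j, by simp, rfl⟩
  let H := (latSpan χ A).addSubgroupOf (latSpan χ Finset.univ)
  let f : ℤ →+ (latSpan χ Finset.univ) ⧸ H :=
    (QuotientAddGroup.mk' H).comp (zmultiplesHom _ ⟨χ j, hjmem⟩)
  have hf : Function.Surjective f := by
    intro q
    obtain ⟨⟨y, hy⟩, rfl⟩ := QuotientAddGroup.mk'_surjective H q
    obtain ⟨c, rfl⟩ := mem_latSpan.1 hy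
    refine ⟨c j, ?_⟩
    change ((_ : latSpan χ Finset.univ) : _ ⧸ H) = ((_ : latSpan χ Finset.univ) : _ ⧸ H)
    rw [QuotientAddGroup.eq]
    change -(c j • χ j) + ∑ i, c i • χ i ∈ latSpan χ A
    rw [← hins, Finset.sum_insert hjA, neg_add_cancel_left]
    exact mem_latSpan.2 ⟨c, rfl⟩
  have hker : f.ker = AddSubgroup.zmultiples (n j) := by
    ext k
    rw [AddMonoidHom.mem_ker, Int.mem_zmultiples_iff, ← hdvd]
    exact QuotientAddGroup.eq_zero_iff _
  rw [AddSubgroup.relIndex, AddSubgroup.index, ← Int.index_zmultiples, ← hker,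
    AddSubgroup.index_ker]
  refine Nat.card_congr ?_
  exact ((Equiv.Set.univ _).symm.trans (Equiv.setCongr (Set.range_eq_univ.2 hf).symm))

theorem latSat_erase_circuit (hC : ∀ S : Finset E, IsCircuit χ S ↔ S = C) {n : E → ℤ}
    (hn : ∑ i ∈ C, n i • χ i = 0) (hn0 : ∃ i ∈ C, n i ≠ 0) {j : E} (hj : j ∈ C) :
    latSat χ (Finset.univ \ {j}) = latSat χ Finset.univ := by
  have hnj := coeff_ne_zero hC hn hn0 hj
  have hle : ∀ A : Finset E, latSat χ A ≤ latSat χ Finset.univ := fun A v hv =>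
    Submodule.span_mono (Set.image_mono (by simp)) hv
  refine le_antisymm (hle _) fun v hv => ?_
  have : Submodule.span ℚ (ratChar χ '' ((Finset.univ : Finset E) : Set E)) ≤
      Submodule.span ℚ (ratChar χ '' ((Finset.univ \ {j} : Finset E) : Set E)) := by
    rw [Submodule.span_le]
    rintro _ ⟨i, _, rfl⟩
    by_cases hij : i = j
    · subst hij
      refine mem_latSat.1 (mem_latSat_of_smul_mem hnj ?_)
      rw [← neg_mem_iff]
      have : -(n i • χ i) = ∑ k ∈ C.erase i, n k • χ k := by
        rw [neg_eq_iff_add_eq_zero, ← hn]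
        exact Finset.add_sum_erase C (fun k => n k • χ k) hj
      rw [this]
      refine sum_mem fun k hk => AddSubgroup.zsmul_mem _ (latSpan_le_latSat _
        (AddSubgroup.subset_closure ⟨k, ?_, rfl⟩)) _
      simpa using Finset.ne_of_mem_erase hk
    · exact Submodule.subset_span ⟨i, by simpa using hij, rfl⟩
  exact this hv

/-- Here g is the gcd of the n_i and m = [Λ^E : Λ_E]. Omitting j ∈ C keeps the saturation and
multiplies the index of the span by |n_j| / g. -/
theorem exists_mult_eq (hC : ∀ S : Finset E, IsCircuit χ S ↔ S = C) {n : E → ℤ}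
    (hn : ∑ i ∈ C, n i • χ i = 0) (hn0 : ∃ i ∈ C, n i ≠ 0) :
    ∃ g m : ℕ, 0 < g ∧ ∀ j ∈ C, g * mult χ (Finset.univ \ {j}) = (n j).natAbs * m := by
  obtain ⟨i, hi, hi0⟩ := hn0
  obtain ⟨n', h1, h2⟩ := C.extract_gcd n ⟨i, hi⟩
  have hg : C.gcd n ≠ 0 := fun h => hi0 (Finset.gcd_eq_zero_iff.1 h i hi)
  have hn' : ∑ i ∈ C, n' i • χ i = 0 := by
    have : C.gcd n • ∑ i ∈ C, n' i • χ i = 0 := by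
      rw [← hn, Finset.smul_sum]
      exact Finset.sum_congr rfl fun i hi => by rw [smul_smul, ← h1 i hi]
    exact (smul_eq_zero.1 this).resolve_left hg
  refine ⟨(C.gcd n).natAbs, (latSpan χ Finset.univ).relIndex (latSat χ Finset.univ),
    Int.natAbs_pos.2 hg, fun j hj => ?_⟩
  have hle : latSpan χ (Finset.univ \ {j}) ≤ latSpan χ Finset.univ :=
    AddSubgroup.closure_mono (Set.image_mono (by simp))
  rw [mult, latSat_erase_circuit hC hn ⟨i, hi, hi0⟩ hj,
    ← AddSubgroup.relIndex_mul_relIndex _ _ _ hle (latSpan_le_latSat Finset.univ),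
    relIndex_latSpan_erase hC hn' h2 hj, h1 j hj, Int.natAbs_mul, mul_assoc]

end Circuit

end

/-! ### The function `c(y) = (y + 1) / (y - 1)` and means over finite quotients of `ℤ^d` -/

/-- The Cayley transform `(y + 1) / (y - 1)`; it is the coefficient of the symmetrised logarithmic
form with respect to `d log y`. -/
def cay (y : ℂ) : ℂ := (y + 1) / (y - 1)

theorem cay_inv {y : ℂ} (hy : y ≠ 0) : cay y⁻¹ = -cay y := by
  unfold cay
  rcases eq_or_ne y 1 with rfl | h1
  -- At y = 1 both sides vanish, since division by zero gives zero.
  · simp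
  · have h2 : y - 1 ≠ 0 := sub_ne_zero.2 h1
    have h3 : y⁻¹ - 1 ≠ 0 := sub_ne_zero.2 (by simpa using h1)
    rw [div_eq_iff h3, neg_mul, div_mul_eq_mul_div, ← neg_div, eq_div_iff h2]
    field_simp
    ring

/-- Write `cay z = 1 + 2 / (z - 1)` and 1 / (z - 1) = (∑_{m < n} z^m) / (z^n - 1). Over z = y ζ^k
the denominator is constant, and summing over k leaves only m = 0. -/
theorem sum_cay_mul_pow {n : ℕ} (hn : n ≠ 0) {ζ y : ℂ} (hζ : IsPrimitiveRoot ζ n) (hy : y ^ n ≠ 1) :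
    ∑ k ∈ Finset.range n, cay (y * ζ ^ k) = n * cay (y ^ n) := by
  have hyn : y ^ n - 1 ≠ 0 := sub_ne_zero.2 hy
  have hz : ∀ k, (y * ζ ^ k) ^ n = y ^ n := by
    intro k
    rw [mul_pow, ← pow_mul, mul_comm k, pow_mul, hζ.pow_eq_one, one_pow, mul_one]
  have h1 : ∀ k, cay (y * ζ ^ k) =
      1 + 2 / (y ^ n - 1) * ∑ m ∈ Finset.range n, y ^ m * (ζ ^ m) ^ k := by
    intro k
    have hk : y * ζ ^ k - 1 ≠ 0 := by
      intro h
      apply hy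
      rw [← hz k, sub_eq_zero.1 h, one_pow]
    have h2 := geom_sum_mul (y * ζ ^ k) n
    rw [hz] at h2
    have h3 : ∑ m ∈ Finset.range n, y ^ m * (ζ ^ m) ^ k =
        ∑ m ∈ Finset.range n, (y * ζ ^ k) ^ m := by
      refine Finset.sum_congr rfl fun m _ => ?_
      rw [mul_pow, ← pow_mul, ← pow_mul, mul_comm m k]
    rw [h3, cay]
    field_simp
    linear_combination (-2) * h2
  have h4 : ∑ k ∈ Finset.range n, ∑ m ∈ Finset.range n, y ^ m * (ζ ^ m) ^ k = n := by
    rw [Finset.sum_comm]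
    simp only [← Finset.mul_sum]
    rw [Finset.sum_eq_single 0]
    · simp
    · intro m hm hm0
      have hm1 : ζ ^ m ≠ 1 := hζ.pow_ne_one_of_pos_of_lt hm0 (Finset.mem_range.1 hm)
      have h5 := geom_sum_mul (ζ ^ m) n
      rw [← pow_mul, mul_comm m, pow_mul, hζ.pow_eq_one, one_pow, sub_self] at h5
      rw [(mul_eq_zero.1 h5).resolve_right (sub_ne_zero.2 hm1), mul_zero]
    · intro h
      exact absurd (Finset.mem_range.2 (Nat.pos_of_ne_zero hn)) h
  simp only [h1, Finset.sum_add_distrib, ← Finset.mul_sum, h4, Finset.sum_const, Finset.card_range,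
    nsmul_eq_mul, mul_one]
  rw [cay]
  field_simp
  ring

open Complex in
theorem sum_cay_exp {n a : ℕ} (hn : n ≠ 0) (ha : a ≠ 0) {s : ℂ} (hs : exp (s / a) ≠ 1) :
    ∑ k ∈ Finset.range n, cay (exp ((s + 2 * Real.pi * I * (a * k : ℕ)) / (a * n : ℕ))) =
      n * cay (exp (s / a)) := by
  have hn' : (n : ℂ) ≠ 0 := by exact_mod_cast hn
  have ha' : (a : ℂ) ≠ 0 := by exact_mod_cast ha
  have hy : exp (s / (a * n : ℕ)) ^ n = exp (s / a) := by
    rw [← exp_nat_mul]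
    congr 1
    push_cast
    field_simp
  rw [← hy, ← sum_cay_mul_pow hn (Complex.isPrimitiveRoot_exp n hn) (by rwa [hy])]
  refine Finset.sum_congr rfl fun k _ => ?_
  rw [← exp_nat_mul, ← exp_add]
  congr 2
  push_cast
  field_simp

section Mean

variable {d R : ℕ} [NeZero R]

/-- Functions on `ℤ^d` that are periodic modulo `R`. -/
def Periodic (R : ℕ) (F : (Fin d → ℤ) → ℂ) : Prop :=
  ∀ v w : Fin d → ℤ, (∀ k, (v k : ZMod R) = w k) → F v = F w

theorem Periodic.sum_add {F : (Fin d → ℤ) → ℂ} (hF : Periodic R F) (w : Fin d → ℤ) :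
    ∑ v : Fin d → ZMod R, F (zlift v + w) = ∑ v : Fin d → ZMod R, F (zlift v) := by
  refine Fintype.sum_equiv (Equiv.addRight fun k => (w k : ZMod R)) _ _ fun v => hF _ _ fun k => ?_
  simp only [Pi.add_apply, Int.cast_add, intCast_zlift, Equiv.coe_addRight]

end Mean

/-- The value of the linear form `ξ` at a complex vector. -/
def pair {d : ℕ} (ξ : Fin d → ℤ) (X : Fin d → ℂ) : ℂ := ∑ k, (ξ k : ℂ) * X k

section Pair

variable {d : ℕ}

theorem pair_add (ξ : Fin d → ℤ) (X Y : Fin d → ℂ) : pair ξ (X + Y) = pair ξ X + pair ξ Y := by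
  simp [pair, mul_add, Finset.sum_add_distrib]

theorem pair_smul (ξ : Fin d → ℤ) (c : ℂ) (X : Fin d → ℂ) : pair ξ (c • X) = c * pair ξ X := by
  simp only [pair, Pi.smul_apply, smul_eq_mul, Finset.mul_sum]
  exact Finset.sum_congr rfl fun k _ => by ring

theorem pair_neg (ξ : Fin d → ℤ) (X : Fin d → ℂ) : pair ξ (-X) = -pair ξ X := by
  simp [pair]

theorem pair_sub (ξ : Fin d → ℤ) (X Y : Fin d → ℂ) : pair ξ (X - Y) = pair ξ X - pair ξ Y := by
  rw [sub_eq_add_neg, pair_add, pair_neg, sub_eq_add_neg]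

theorem pair_zero (ξ : Fin d → ℤ) : pair ξ 0 = 0 := by simp [pair]

theorem pair_intCast (ξ v : Fin d → ℤ) : pair ξ (fun k => (v k : ℂ)) = (ξ ⬝ᵥ v : ℤ) := by
  simp [pair, dotProduct]

theorem zsmul_pair (m : ℤ) (ξ : Fin d → ℤ) (X : Fin d → ℂ) : pair (m • ξ) X = m * pair ξ X := by
  simp [pair, Finset.mul_sum, mul_assoc]

theorem sum_pair {ι : Type*} (s : Finset ι) (ξ : ι → Fin d → ℤ) (X : Fin d → ℂ) :
    pair (∑ i ∈ s, ξ i) X = ∑ i ∈ s, pair (ξ i) X := by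
  simp only [pair, Finset.sum_apply, Int.cast_sum, Finset.sum_mul]
  exact Finset.sum_comm

end Pair

/-! ### Means of products of hyperbolic cotangents -/

section MeanForm

open Complex

variable {E : Type*} {d : ℕ} {χ : E → Fin d → ℤ}

/-- The value `(χ_i(X) + 2π√-1 χ_i(v)) / a_i`. -/
def logArg (χ : E → Fin d → ℤ) (a : E → ℕ) (X : Fin d → ℂ) (v : Fin d → ℤ) (i : E) : ℂ :=
  (pair (χ i) X + 2 * Real.pi * I * (χ i ⬝ᵥ v : ℤ)) / a i

/-- The product of the functions `coth (logArg / 2)`, `i ∈ A`. -/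
def cothProd (χ : E → Fin d → ℤ) (a : E → ℕ) (A : Finset E) (X : Fin d → ℂ) (v : Fin d → ℤ) : ℂ :=
  ∏ i ∈ A, cay (exp (logArg χ a X v i))

/-- The mean of the functions `cothProd` over `(ℤ / R)^d`, up to the factor `R ^ d`. -/
def cothSum (χ : E → Fin d → ℤ) (a : E → ℕ) (R : ℕ) [NeZero R] (A : Finset E) (X : Fin d → ℂ) : ℂ :=
  ∑ v : Fin d → ZMod R, cothProd χ a A X (zlift v)

theorem exp_logArg_congr {a : E → ℕ} {X : Fin d → ℂ} {i : E} (ha : a i ≠ 0) {v w : Fin d → ℤ}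
    (h : (a i : ℤ) ∣ χ i ⬝ᵥ v - χ i ⬝ᵥ w) :
    exp (logArg χ a X v i) = exp (logArg χ a X w i) := by
  obtain ⟨c, hc⟩ := h
  rw [exp_eq_exp_iff_exists_int]
  refine ⟨c, ?_⟩
  have ha' : (a i : ℂ) ≠ 0 := by exact_mod_cast ha
  have : ((χ i ⬝ᵥ v : ℤ) : ℂ) = (χ i ⬝ᵥ w : ℤ) + a i * c := by
    rw [sub_eq_iff_eq_add] at hc
    rw [hc]; push_cast; ring
  rw [logArg, logArg, this]
  field_simp
  ring

theorem periodic_cothProd {a : E → ℕ} {R : ℕ} [NeZero R] {A : Finset E} (haR : ∀ i ∈ A, a i ∣ R)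
    (X : Fin d → ℂ) : Periodic R (cothProd χ a A X) := by
  intro v w h
  refine Finset.prod_congr rfl fun i hi => ?_
  have ha : a i ≠ 0 := fun h0 => NeZero.ne R (by simpa [h0] using haR i hi)
  rw [exp_logArg_congr ha]
  rw [← dotProduct_sub]
  refine Finset.dvd_sum fun k _ => Dvd.dvd.mul_left ?_ _
  refine (Int.natCast_dvd_natCast.2 (haR i hi)).trans ?_
  exact (ZMod.intCast_eq_intCast_iff_dvd_sub _ _ _).1 (h k).symm

theorem cothProd_add_two_pi (a : E → ℕ) (A : Finset E) (X : Fin d → ℂ) (w v : Fin d → ℤ) :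
    cothProd χ a A (X + (2 * Real.pi * I : ℂ) • fun k => (w k : ℂ)) v =
      cothProd χ a A X (v + w) := by
  refine Finset.prod_congr rfl fun i _ => ?_
  rw [logArg, logArg, pair_add, pair_smul, pair_intCast, dotProduct_add]
  push_cast
  congr 3
  ring

/-- Another choice of logarithm translates the summation variable, so the mean depends only on the
point e^X. -/
theorem cothSum_add_two_pi {a : E → ℕ} {R : ℕ} [NeZero R] {A : Finset E} (haR : ∀ i ∈ A, a i ∣ R)
    (X : Fin d → ℂ) (w : Fin d → ℤ) :
    cothSum χ a R A (X + (2 * Real.pi * I : ℂ) • fun k => (w k : ℂ)) = cothSum χ a R A X := by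
  simp only [cothSum, cothProd_add_two_pi]
  exact (periodic_cothProd haR X).sum_add w

/-- Refinement: the mean does not change when the `a_i` are replaced by multiples. -/
theorem cothSum_refine {a n : E → ℕ} {R : ℕ} [NeZero R] {A : Finset E}
    (haR : ∀ i ∈ A, a i * n i ∣ R)
    (hw : ∀ i ∈ A, ∃ w : Fin d → ℤ, χ i ⬝ᵥ w = a i ∧ ∀ k ∈ A, k ≠ i → χ k ⬝ᵥ w = 0)
    {X : Fin d → ℂ} (hX : ∀ i ∈ A, exp (pair (χ i) X) ≠ 1) :
    cothSum χ a R A X = cothSum χ (fun i => a i * n i) R A X := by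
  classical
  have h0 : ∀ i ∈ A, a i ≠ 0 ∧ n i ≠ 0 := fun i hi => by
    rw [← mul_ne_zero_iff]
    exact fun h0 => NeZero.ne R (by simpa [h0] using haR i hi)
  choose! w hw1 hw2 using hw
  -- The multiplication formula splits the i-th factor into n_i terms. The k-th one is the
  -- translation of v by k w_i, which adds a_i k to χ_i(v) and leaves the other pairings alone.
  have hprod : ∀ v : Fin d → ℤ, (∏ i ∈ A, (n i : ℂ)) * cothProd χ a A X v =
      ∑ κ ∈ A.pi fun i => Finset.range (n i),
        cothProd χ (fun i => a i * n i) A X (v + ∑ i ∈ A.attach, κ i i.2 • w i) := by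
    intro v
    rw [cothProd, ← Finset.prod_mul_distrib]
    have h1 : ∀ i ∈ A, (n i : ℂ) * cay (exp (logArg χ a X v i)) =
        ∑ k ∈ Finset.range (n i), cay (exp ((pair (χ i) X + 2 * Real.pi * I * (χ i ⬝ᵥ v : ℤ) +
          2 * Real.pi * I * (a i * k : ℕ)) / (a i * n i : ℕ))) := by
      intro i hi
      rw [logArg, sum_cay_exp (h0 i hi).2 (h0 i hi).1]
      intro h
      apply hX i hi
      have h2 : exp ((a i : ℂ) * ((pair (χ i) X + 2 * Real.pi * I * (χ i ⬝ᵥ v : ℤ)) / a i)) = 1 := by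
        rw [exp_nat_mul, h, one_pow]
      rw [mul_div_cancel₀ _ (by exact_mod_cast (h0 i hi).1), exp_add,
        show (2 * Real.pi * I * (χ i ⬝ᵥ v : ℤ) : ℂ) = (χ i ⬝ᵥ v : ℤ) * (2 * Real.pi * I) by ring,
        exp_int_mul_two_pi_mul_I, mul_one] at h2
      exact h2
    rw [Finset.prod_congr rfl h1, Finset.prod_sum]
    refine Finset.sum_congr rfl fun κ _ => ?_
    rw [cothProd, ← Finset.prod_attach A]
    refine Finset.prod_congr rfl fun i _ => ?_
    have h3 : χ i ⬝ᵥ ∑ j ∈ A.attach, κ j j.2 • w j = (a i * κ i i.2 : ℕ) := by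
      rw [dotProduct_sum, Finset.sum_eq_single i]
      · rw [dotProduct_smul, hw1 i i.2]
        push_cast
        rw [nsmul_eq_mul, mul_comm]
      · intro j _ hj
        rw [dotProduct_smul, hw2 j j.2 i i.2 (fun h => hj (Subtype.ext h.symm)), smul_zero]
      · simp
    rw [logArg, dotProduct_add, h3]
    push_cast
    congr 3
    ring
  have hn : (∏ i ∈ A, (n i : ℂ)) ≠ 0 :=
    Finset.prod_ne_zero_iff.2 fun i hi => by exact_mod_cast (h0 i hi).2
  apply mul_left_cancel₀ hn
  rw [cothSum, Finset.mul_sum]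
  simp only [hprod]
  rw [Finset.sum_comm]
  -- All ∏ n_i translates have the same sum over (ℤ/R)^d.
  simp only [(periodic_cothProd haR X).sum_add]
  rw [Finset.sum_const, Finset.card_pi, nsmul_eq_mul, cothSum]
  simp

end MeanForm

/-! ### The exponential parametrisation of the torus -/

section Exp

open Complex

variable {d : ℕ}

/-- The exponential map `ℂ^d → T`. -/
def exps (X : Fin d → ℂ) : Fin d → ℂ := fun k => exp (X k)

theorem exps_mem_torus (X : Fin d → ℂ) : exps X ∈ torus d := fun _ => exp_ne_zero _

theorem exps_add (X Y : Fin d → ℂ) : exps (X + Y) = exps X * exps Y :=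
  funext fun _ => exp_add _ _

theorem exps_zero : exps (0 : Fin d → ℂ) = 1 := funext fun _ => exp_zero

theorem mul_mem_torus {x y : Fin d → ℂ} (hx : x ∈ torus d) (hy : y ∈ torus d) : x * y ∈ torus d :=
  fun k => mul_ne_zero (hx k) (hy k)

theorem one_mem_torus : (1 : Fin d → ℂ) ∈ torus d := fun _ => one_ne_zero

theorem exists_eq_mul_exps {x p : Fin d → ℂ} (hx : x ∈ torus d) (hp : p ∈ torus d) :
    ∃ X, x = p * exps X := by
  refine ⟨fun k => log (x k / p k), funext fun k => ?_⟩
  rw [Pi.mul_apply, exps, exp_log (div_ne_zero (hx k) (hp k)), mul_div_cancel₀ _ (hp k)]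

theorem exps_eq_exps_iff {X Y : Fin d → ℂ} :
    exps X = exps Y ↔
      ∃ w : Fin d → ℤ, X = Y + (2 * Real.pi * I : ℂ) • fun k => (w k : ℂ) := by
  rw [funext_iff]
  simp only [exps, exp_eq_exp_iff_exists_int, funext_iff, Pi.add_apply, Pi.smul_apply, smul_eq_mul]
  constructor
  · intro h
    choose w hw using h
    exact ⟨w, fun k => by rw [hw k, mul_comm]⟩
  · rintro ⟨w, hw⟩ k
    exact ⟨w k, by rw [hw k, mul_comm]⟩

theorem exps_two_pi (w : Fin d → ℤ) : exps ((2 * Real.pi * I : ℂ) • fun k => (w k : ℂ)) = 1 := by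
  rw [← exps_zero]
  exact exps_eq_exps_iff.2 ⟨w, (zero_add _).symm⟩

theorem mul_exps_cancel {p X Y : Fin d → ℂ} (hp : p ∈ torus d) (h : p * exps X = p * exps Y) :
    exps X = exps Y :=
  funext fun k => mul_left_cancel₀ (hp k) (congrFun h k)

theorem chr_mul (ξ : Fin d → ℤ) (x y : Fin d → ℂ) : chr ξ (x * y) = chr ξ x * chr ξ y := by
  simp only [chr, Pi.mul_apply, mul_zpow, Finset.prod_mul_distrib]

theorem chr_one (ξ : Fin d → ℤ) : chr ξ 1 = 1 := by simp [chr]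

theorem chr_exps (ξ : Fin d → ℤ) (X : Fin d → ℂ) : chr ξ (exps X) = exp (pair ξ X) := by
  simp only [chr, exps, pair, exp_sum, exp_int_mul]

theorem chr_ne_zero (ξ : Fin d → ℤ) {x : Fin d → ℂ} (hx : x ∈ torus d) : chr ξ x ≠ 0 :=
  Finset.prod_ne_zero_iff.2 fun k _ => zpow_ne_zero _ (hx k)

theorem chr_mul_exps (ξ : Fin d → ℤ) (p X : Fin d → ℂ) :
    chr ξ (p * exps X) = chr ξ p * exp (pair ξ X) := by
  rw [chr_mul, chr_exps]

theorem chr_nsmul (a : ℕ) (ξ : Fin d → ℤ) (x : Fin d → ℂ) :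
    chr ((a : ℤ) • ξ) x = chr ξ x ^ a := by
  simp only [chr, ← Finset.prod_pow, Pi.smul_apply, smul_eq_mul]
  refine Finset.prod_congr rfl fun k _ => ?_
  rw [mul_comm, zpow_mul, zpow_natCast]

theorem continuous_exps : Continuous (exps : (Fin d → ℂ) → Fin d → ℂ) := by
  unfold exps
  fun_prop

/-! ### Monomial coverings -/

variable {P : Matrix (Fin d) (Fin d) ℤ}

theorem cover_mul (x y : Fin d → ℂ) : cover P (x * y) = cover P x * cover P y :=
  funext fun k => chr_mul (P k) x y

theorem cover_exps (U : Fin d → ℂ) : cover P (exps U) = exps fun k => pair (P k) U :=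
  funext fun k => chr_exps (P k) U

theorem cover_mem_torus {u : Fin d → ℂ} (hu : u ∈ torus d) : cover P u ∈ torus d :=
  fun k => chr_ne_zero (P k) hu

theorem pair_pair (ξ : Fin d → ℤ) (U : Fin d → ℂ) :
    pair ξ (fun k => pair (P k) U) = pair (ξ ᵥ* P) U := by
  simp only [pair, Matrix.vecMul, dotProduct, Int.cast_sum, Int.cast_mul, Finset.mul_sum,
    Finset.sum_mul]
  rw [Finset.sum_comm]
  exact Finset.sum_congr rfl fun l _ => Finset.sum_congr rfl fun k _ => by ring

theorem chr_cover (ξ : Fin d → ℤ) {u : Fin d → ℂ} (hu : u ∈ torus d) :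
    chr ξ (cover P u) = chr (ξ ᵥ* P) u := by
  obtain ⟨U, rfl⟩ := exists_eq_mul_exps hu one_mem_torus
  rw [one_mul, cover_exps, chr_exps, chr_exps, pair_pair]

theorem exists_pair_eq (hP : P.det ≠ 0) (X : Fin d → ℂ) :
    ∃ U : Fin d → ℂ, (fun k => pair (P k) U) = X := by
  have hdet : IsUnit (P.map (Int.cast : ℤ → ℂ)).det := by
    have : (P.map (Int.cast : ℤ → ℂ)).det = ((P.det : ℤ) : ℂ) :=
      ((Int.castRingHom ℂ).map_det P).symm
    rw [this, isUnit_iff_ne_zero]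
    exact_mod_cast hP
  refine ⟨(P.map (Int.cast : ℤ → ℂ))⁻¹ *ᵥ X, ?_⟩
  have h : (P.map (Int.cast : ℤ → ℂ)) *ᵥ ((P.map (Int.cast : ℤ → ℂ))⁻¹ *ᵥ X) = X := by
    rw [Matrix.mulVec_mulVec, Matrix.mul_nonsing_inv _ hdet, Matrix.one_mulVec]
  exact h

theorem exists_cover_eq (hP : P.det ≠ 0) {x : Fin d → ℂ} (hx : x ∈ torus d) :
    ∃ u ∈ torus d, cover P u = x := by
  obtain ⟨X, rfl⟩ := exists_eq_mul_exps hx one_mem_torus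
  obtain ⟨U, rfl⟩ := exists_pair_eq hP X
  exact ⟨exps U, exps_mem_torus U, by rw [cover_exps, one_mul]⟩

/-! ### Primitive vectors -/

/-- Here g generates the ideal spanned by the entries of η, and w is a Bézout vector. -/
theorem exists_primitive_factor {η : Fin d → ℤ} (hη : η ≠ 0) :
    ∃ (g : ℕ) (ξ w : Fin d → ℤ), 0 < g ∧ η = (g : ℤ) • ξ ∧ ξ ⬝ᵥ w = 1 := by
  obtain ⟨g, hg⟩ := (IsPrincipalIdealRing.principal (Ideal.span (Set.range η))).principal
  have hg' : Ideal.span (Set.range η) = Ideal.span {(g.natAbs : ℤ)} := by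
    rw [hg, Ideal.submodule_span_eq, Ideal.span_singleton_eq_span_singleton]
    exact (Int.associated_natAbs g)
  have hdvd : ∀ k, (g.natAbs : ℤ) ∣ η k := fun k => by
    rw [← Ideal.mem_span_singleton, ← hg']
    exact Ideal.subset_span ⟨k, rfl⟩
  choose ξ hξ using hdvd
  have hmem : (g.natAbs : ℤ) ∈ Ideal.span (Set.range η) := by
    rw [hg']
    exact Ideal.mem_span_singleton_self _
  obtain ⟨w, hw⟩ := Ideal.mem_span_range_iff_exists_fun.1 hmem
  have hg0 : (g.natAbs : ℤ) ≠ 0 := by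
    intro h
    exact hη (funext fun k => by rw [hξ k, h, zero_mul]; rfl)
  refine ⟨g.natAbs, ξ, w, Nat.pos_of_ne_zero (by exact_mod_cast hg0), funext hξ, ?_⟩
  apply mul_left_cancel₀ hg0
  rw [mul_one, dotProduct, Finset.mul_sum]
  refine Eq.trans (Finset.sum_congr rfl fun k _ => ?_) hw
  rw [hξ k]
  ring

theorem IsPrimitive.exists_dotProduct_eq_one {ξ : Fin d → ℤ} (h : IsPrimitive ξ) :
    ∃ w, ξ ⬝ᵥ w = 1 := by
  have h0 : ξ ≠ 0 := by
    rintro rfl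
    exact not_isUnit_zero (h 0 0 (by simp))
  obtain ⟨g, ξ', w, hg, he, hw⟩ := exists_primitive_factor h0
  have : g = 1 := by simpa [Int.isUnit_iff] using h g ξ' he
  refine ⟨w, ?_⟩
  rw [he, this]
  simpa using hw

theorem IsPrimitive.vecMul_ne_zero {ξ : Fin d → ℤ} (h : IsPrimitive ξ) (hP : P.det ≠ 0) :
    ξ ᵥ* P ≠ 0 := by
  intro h0
  have h1 : ξ = 0 := by
    by_contra hne
    exact hP (Matrix.exists_vecMul_eq_zero_iff.1 ⟨ξ, hne, h0⟩)
  subst h1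
  exact not_isUnit_zero (h 0 0 (by simp))

end Exp

/-! ### Connected components of intersections of hypertori -/

section Components

open Complex

variable {E : Type*} {d : ℕ} {χ : E → Fin d → ℤ}

theorem mem_hypInter {A : Finset E} {x : Fin d → ℂ} :
    x ∈ hypInter χ A ↔ x ∈ torus d ∧ ∀ i ∈ A, chr (χ i) x = 1 := by
  simp only [hypInter, hyp, Set.mem_inter_iff, Set.mem_iInter, Set.mem_ofPred_eq]
  exact ⟨fun h => ⟨h.1, fun i hi => (h.2 i hi).2⟩, fun h => ⟨h.1, fun i hi => ⟨h.1, h.2 i hi⟩⟩⟩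

theorem tendsto_pair_log (ξ : Fin d → ℤ) {x : Fin d → ℂ} (hx : x ∈ torus d) :
    Filter.Tendsto (fun y : Fin d → ℂ => pair ξ fun k => log (y k / x k)) (nhds x) (nhds 0) := by
  unfold pair
  rw [show (0 : ℂ) = ∑ k, (ξ k : ℂ) * 0 by simp]
  refine tendsto_finsetSum _ fun k _ => Filter.Tendsto.const_mul _ ?_
  have h1 : Filter.Tendsto (fun y : Fin d → ℂ => y k / x k) (nhds x) (nhds 1) := by
    rw [← div_self (hx k)]
    exact ((continuous_apply k).tendsto x).div_const (x k)
  rw [← log_one]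
  exact (continuousAt_clog one_mem_slitPlane).tendsto.comp h1

/-- Being related by e^Y with all χ_i(Y) = 0 is an equivalence relation that holds between nearby
points: there χ_i of the logarithm of the ratio is a small multiple of 2π√-1, hence 0. So a
component stays in one class. Conversely a class is the continuous image of a convex set. -/
theorem connectedComponentIn_hypInter {A : Finset E} {p : Fin d → ℂ} (hp : p ∈ hypInter χ A) :
    connectedComponentIn (hypInter χ A) p =
      {x | ∃ Y, (∀ i ∈ A, pair (χ i) Y = 0) ∧ x = p * exps Y} := by
  apply Set.Subset.antisymm
  · intro x hx
    refine isPreconnected_connectedComponentIn.induction₂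
      (fun x y => ∃ Y, (∀ i ∈ A, pair (χ i) Y = 0) ∧ y = x * exps Y) ?_ ?_ ?_
      (mem_connectedComponentIn hp) hx
    · intro x hx
      have hxS := mem_hypInter.1 (connectedComponentIn_subset _ _ hx)
      have hsmall : ∀ᶠ y in nhds x, ∀ i ∈ A, ‖pair (χ i) fun k => log (y k / x k)‖ < 1 := by
        rw [Filter.eventually_all_finset]
        intro i hi
        exact (tendsto_norm_zero.comp (tendsto_pair_log (χ i) hxS.1)).eventually_lt_const one_pos
      filter_upwards [nhdsWithin_le_nhds hsmall, self_mem_nhdsWithin] with y hy hyS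
      have hyS' := mem_hypInter.1 (connectedComponentIn_subset _ _ hyS)
      have hyx : y = x * exps fun k => log (y k / x k) := funext fun k => by
        rw [Pi.mul_apply, exps, exp_log (div_ne_zero (hyS'.1 k) (hxS.1 k)),
          mul_div_cancel₀ _ (hxS.1 k)]
      refine ⟨_, fun i hi => ?_, hyx⟩
      have h1 := hyS'.2 i hi
      rw [hyx, chr_mul_exps, hxS.2 i hi, one_mul, exp_eq_one_iff] at h1
      obtain ⟨m, hm⟩ := h1
      have h2 := hy i hi
      rw [hm] at h2 ⊢
      rcases eq_or_ne m 0 with rfl | hm0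
      · simp
      · exfalso
        have h3 : (1 : ℝ) ≤ |(m : ℝ)| := by exact_mod_cast Int.one_le_abs hm0
        have h4 : ‖(m : ℂ) * (2 * Real.pi * I)‖ = |(m : ℝ)| * (2 * Real.pi) := by
          simp [abs_of_pos Real.pi_pos]
        rw [h4] at h2
        nlinarith [Real.pi_gt_three]
    · rintro x y z _ _ _ ⟨Y, hY, rfl⟩ ⟨Z, hZ, rfl⟩
      exact ⟨Y + Z, fun i hi => by rw [pair_add, hY i hi, hZ i hi, add_zero],
        by rw [exps_add, mul_assoc]⟩
    · rintro x y _ _ ⟨Y, hY, rfl⟩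
      exact ⟨-Y, fun i hi => by rw [pair_neg, hY i hi, neg_zero],
        by rw [mul_assoc, ← exps_add, add_neg_cancel, exps_zero, mul_one]⟩
  · refine IsPreconnected.subset_connectedComponentIn ?_ ⟨0, fun i _ => pair_zero _,
      by rw [exps_zero, mul_one]⟩ ?_
    · have h1 : {x | ∃ Y, (∀ i ∈ A, pair (χ i) Y = 0) ∧ x = p * exps Y} =
          (fun Y => p * exps Y) '' {Y | ∀ i ∈ A, pair (χ i) Y = 0} := by
        ext x
        simp [eq_comm]
      rw [h1]
      refine IsPreconnected.image (Convex.isPreconnected ?_) _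
        (continuous_const.mul continuous_exps).continuousOn
      intro Y hY Z hZ s t _ _ _ i hi
      have h2 : s • Y + t • Z = (s : ℂ) • Y + (t : ℂ) • Z := by ext; simp
      rw [h2, pair_add, pair_smul, pair_smul, hY i hi, hZ i hi, mul_zero, mul_zero, add_zero]
    · rintro x ⟨Y, hY, rfl⟩
      have hp' := mem_hypInter.1 hp
      exact mem_hypInter.2 ⟨mul_mem_torus hp'.1 (exps_mem_torus _), fun i hi => by
        rw [chr_mul_exps, hp'.2 i hi, hY i hi, exp_zero, mul_one]⟩

variable {P : Matrix (Fin d) (Fin d) ℤ}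

theorem mem_preHyp {i : E} {u : Fin d → ℂ} :
    u ∈ preHyp χ P i ↔ u ∈ torus d ∧ chr (χ i) (cover P u) = 1 :=
  ⟨fun h => ⟨h.1, h.2.2⟩, fun h => ⟨h.1, cover_mem_torus h.1, h.2⟩⟩

section Factor

variable {i : E} {g : ℕ} {ξ w : Fin d → ℤ}

theorem liftHyp_of_factor (hg : 0 < g) (h : χ i ᵥ* P = (g : ℤ) • ξ) (hw : ξ ⬝ᵥ w = 1)
    {q : Fin d → ℂ} (hq : q ∈ preHyp χ P i) :
    liftHyp χ P i q = {u | u ∈ torus d ∧ chr ξ u = chr ξ q} := by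
  have hg0 : (g : ℂ) ≠ 0 := by exact_mod_cast hg.ne'
  have hpre : preHyp χ P i = hypInter (fun _ : Unit => (g : ℤ) • ξ) Finset.univ := by
    ext u
    rw [mem_preHyp, mem_hypInter]
    refine and_congr_right fun hu => ?_
    rw [chr_cover _ hu, h]
    simp
  rw [liftHyp, hpre, connectedComponentIn_hypInter (hpre ▸ hq)]
  ext u
  simp only [Finset.mem_univ, forall_const, zsmul_pair, Int.cast_natCast, mul_eq_zero, hg0,
    false_or, Set.mem_ofPred_eq]
  constructor
  · rintro ⟨Y, hY, rfl⟩
    exact ⟨mul_mem_torus hq.1 (exps_mem_torus _), by rw [chr_mul_exps, hY, exp_zero, mul_one]⟩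
  · rintro ⟨hu, hc⟩
    obtain ⟨Y, rfl⟩ := exists_eq_mul_exps hu hq.1
    rw [chr_mul_exps, mul_eq_left₀ (chr_ne_zero ξ hq.1), exp_eq_one_iff] at hc
    obtain ⟨m, hm⟩ := hc
    -- Because ξ(w) = 1, subtracting 2π√-1 m w makes ξ vanish on the logarithm without moving the
    -- point; this is why level sets of a primitive character are connected.
    refine ⟨Y + (2 * Real.pi * I : ℂ) • fun k => ((-(m • w)) k : ℂ), ?_, ?_⟩
    · rw [pair_add, pair_smul, pair_intCast, hm, dotProduct_neg, dotProduct_smul, hw]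
      push_cast
      simp
      ring
    · rw [exps_add, exps_two_pi, mul_one]

/-- The components are the level sets of e^ξ at the g-th roots of unity, all nonempty because ξ(w) =
1 makes e^ξ surjective onto ℂ^*. -/
theorem numComp_of_factor (hg : 0 < g) (h : χ i ᵥ* P = (g : ℤ) • ξ) (hw : ξ ⬝ᵥ w = 1) :
    numComp χ P i = g := by
  have hmem : ∀ u, u ∈ preHyp χ P i ↔ u ∈ torus d ∧ chr ξ u ^ g = 1 := by
    intro u
    rw [mem_preHyp]
    refine and_congr_right fun hu => ?_
    rw [chr_cover _ hu, h, chr_nsmul]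
  have hex : ∀ z : ℂ, z ≠ 0 → ∃ u ∈ torus d, chr ξ u = z := by
    intro z hz
    refine ⟨exps (log z • fun k => (w k : ℂ)), exps_mem_torus _, ?_⟩
    rw [chr_exps, pair_smul, pair_intCast, hw, Int.cast_one, mul_one, exp_log hz]
  have hne : ∀ z ∈ Polynomial.nthRootsFinset g (1 : ℂ), z ≠ 0 := by
    intro z hz h0
    rw [Polynomial.mem_nthRootsFinset hg, h0, zero_pow hg.ne'] at hz
    exact zero_ne_one hz
  have heq : {W | IsComponent (preHyp χ P i) W} =
      (fun z => {u | u ∈ torus d ∧ chr ξ u = z}) '' (Polynomial.nthRootsFinset g (1 : ℂ) : Set ℂ) := by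
    ext W
    constructor
    · rintro ⟨q, hq, rfl⟩
      exact ⟨chr ξ q, (Polynomial.mem_nthRootsFinset hg _).2 ((hmem q).1 hq).2,
        (liftHyp_of_factor hg h hw hq).symm⟩
    · rintro ⟨z, hz, rfl⟩
      obtain ⟨u, hu, rfl⟩ := hex z (hne z hz)
      have hu' := (hmem u).2 ⟨hu, (Polynomial.mem_nthRootsFinset hg _).1 hz⟩
      exact ⟨u, hu', (liftHyp_of_factor hg h hw hu').symm⟩
  rw [numComp, heq, Set.InjOn.ncard_image, Set.ncard_coe_finset,
    (Complex.isPrimitiveRoot_exp g hg.ne').card_nthRootsFinset]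
  intro z hz z' _ hzz
  obtain ⟨u, hu, rfl⟩ := hex z (hne z hz)
  have : u ∈ {u | u ∈ torus d ∧ chr ξ u = z'} := by
    refine (Set.ext_iff.1 hzz u).1 ?_
    exact ⟨hu, rfl⟩
  exact this.2

theorem liftChar_of_factor (hg : 0 < g) (h : χ i ᵥ* P = (g : ℤ) • ξ) (hw : ξ ⬝ᵥ w = 1) :
    liftChar χ P i = ξ := by
  have hg0 : (g : ℤ) ≠ 0 := by exact_mod_cast hg.ne'
  ext l
  rw [liftChar, numComp_of_factor hg h hw, h, Pi.smul_apply, smul_eq_mul,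
    Int.mul_ediv_cancel_left _ hg0]

end Factor

theorem numComp_pos {i : E} (hi : IsPrimitive (χ i)) (hP : P.det ≠ 0) : 0 < numComp χ P i := by
  obtain ⟨g, ξ, w, hg, h, hw⟩ := exists_primitive_factor (hi.vecMul_ne_zero hP)
  rwa [numComp_of_factor hg h hw]

theorem vecMul_eq_numComp_smul {i : E} (hi : IsPrimitive (χ i)) (hP : P.det ≠ 0) :
    χ i ᵥ* P = (numComp χ P i : ℤ) • liftChar χ P i := by
  obtain ⟨g, ξ, w, hg, h, hw⟩ := exists_primitive_factor (hi.vecMul_ne_zero hP)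
  rw [numComp_of_factor hg h hw, liftChar_of_factor hg h hw, h]

theorem liftHyp_eq {i : E} (hi : IsPrimitive (χ i)) (hP : P.det ≠ 0) {q : Fin d → ℂ}
    (hq : q ∈ preHyp χ P i) :
    liftHyp χ P i q = {u | u ∈ torus d ∧ chr (liftChar χ P i) u = chr (liftChar χ P i) q} := by
  obtain ⟨g, ξ, w, hg, h, hw⟩ := exists_primitive_factor (hi.vecMul_ne_zero hP)
  rw [liftHyp_of_factor hg h hw hq, liftChar_of_factor hg h hw]

theorem numComp_mul_pair_liftChar {i : E} (hi : IsPrimitive (χ i)) (hP : P.det ≠ 0)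
    (U : Fin d → ℂ) :
    (numComp χ P i : ℂ) * pair (liftChar χ P i) U = pair (χ i) fun k => pair (P k) U := by
  rw [pair_pair, vecMul_eq_numComp_smul hi hP, zsmul_pair, Int.cast_natCast]

/-! ### Separating coverings -/

variable [DecidableEq E]

/-- Take the layer through 1. A translation by e^U on the cover on which every χ̂_k / a_k with k ∈ A
is trivial preserves intersections of lifted hypertori, so by separation its image stays in the
identity component. Choosing U with χ̂_k(U) = 2π√-1 a_i δ_ik, the period v that brings its logarithm
into the tangent space is the cocharacter sought. -/
theorem Separates.exists_dotProduct_eq (hprim : ∀ i, IsPrimitive (χ i)) (hP : P.det ≠ 0)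
    {A : Finset E} (hA : LinearIndepOn ℚ (ratChar χ) (A : Set E)) (hs : Separates χ P A) :
    ∀ i ∈ A, ∃ w : Fin d → ℤ, χ i ⬝ᵥ w = numComp χ P i ∧ ∀ k ∈ A, k ≠ i → χ k ⬝ᵥ w = 0 := by
  intro i hi
  obtain ⟨b, hb, w, hw⟩ := exists_dual_family hA
  have hb0 : (b : ℂ) ≠ 0 := by exact_mod_cast hb.ne'
  have hpi : (2 * Real.pi * I : ℂ) ≠ 0 := two_pi_I_ne_zero
  have h1 : (1 : Fin d → ℂ) ∈ hypInter χ A :=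
    mem_hypInter.2 ⟨one_mem_torus, fun i _ => chr_one _⟩
  obtain ⟨q, hq, hW⟩ := hs _ ⟨1, h1, rfl⟩
  have h1W := mem_connectedComponentIn h1
  rw [← hW] at h1W
  obtain ⟨u, ⟨hu, huq⟩, hu1⟩ := h1W
  let X : Fin d → ℂ := (2 * Real.pi * I * numComp χ P i / b) • fun k => (w i k : ℂ)
  obtain ⟨U, hU⟩ := exists_pair_eq hP X
  have hXk : ∀ k ∈ A, pair (χ k) X = if k = i then 2 * Real.pi * I * numComp χ P i else 0 := by
    intro k hk
    rw [pair_smul, pair_intCast, hw k hk i hi]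
    split_ifs
    · rw [Int.cast_natCast, div_mul_cancel₀ _ hb0]
    · simp
  have hmem : u * exps U ∈ torus d ∩ ⋂ i ∈ A, liftHyp χ P i (q i) := by
    refine ⟨mul_mem_torus hu (exps_mem_torus U), Set.mem_iInter₂.2 fun k hk => ?_⟩
    have huk := Set.mem_iInter₂.1 huq k hk
    rw [liftHyp_eq (hprim k) hP (hq k hk)] at huk ⊢
    refine ⟨mul_mem_torus hu (exps_mem_torus U), ?_⟩
    rw [chr_mul_exps, huk.2]
    have h2 := numComp_mul_pair_liftChar (hprim k) hP U
    have h3 : (numComp χ P k : ℂ) ≠ 0 := by exact_mod_cast (numComp_pos (hprim k) hP).ne'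
    rw [hU, hXk k hk] at h2
    have h4 : exp (pair (liftChar χ P k) U) = 1 := by
      split_ifs at h2 with hki
      · subst hki
        rw [mul_comm, mul_left_inj' h3] at h2
        rw [h2, exp_two_pi_mul_I]
      · rw [(mul_eq_zero.1 h2).resolve_left h3, exp_zero]
    rw [h4, mul_one]
  have hX : exps X ∈ connectedComponentIn (hypInter χ A) 1 := by
    rw [← hW]
    exact ⟨_, hmem, by rw [cover_mul, hu1, cover_exps, hU, one_mul]⟩
  rw [connectedComponentIn_hypInter h1] at hX
  obtain ⟨Y, hY, hXY⟩ := hX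
  rw [one_mul, exps_eq_exps_iff] at hXY
  obtain ⟨v, hv⟩ := hXY
  have hval : ∀ k ∈ A, (2 * Real.pi * I : ℂ) * (χ k ⬝ᵥ v : ℤ) =
      if k = i then 2 * Real.pi * I * numComp χ P i else 0 := by
    intro k hk
    rw [← hXk k hk, hv, pair_add, pair_smul, pair_intCast, hY k hk, zero_add]
  refine ⟨v, ?_, fun k hk hki => ?_⟩
  · have := hval i hi
    rw [if_pos rfl, mul_right_inj' hpi] at this
    exact_mod_cast this
  · have := hval k hk
    rw [if_neg hki] at this
    exact_mod_cast (mul_eq_zero.1 this).resolve_left hpi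

/-- The b-th power map works, with b from the dual family. On a lifted layer the χ_i(U) are periods
2π√-1 m_i, and after applying the covering they are cancelled by ∑ m_i w_i, as χ_i(w_i) = b. -/
theorem exists_separates (hprim : ∀ i, IsPrimitive (χ i)) {A : Finset E}
    (hA : LinearIndepOn ℚ (ratChar χ) (A : Set E)) :
    ∃ Q : Matrix (Fin d) (Fin d) ℤ, Q.det ≠ 0 ∧ Separates χ Q A := by
  obtain ⟨b, hb, w, hw⟩ := exists_dual_family hA
  have hb0 : (b : ℂ) ≠ 0 := by exact_mod_cast hb.ne'
  have hdet : ((b : ℤ) • (1 : Matrix (Fin d) (Fin d) ℤ)).det ≠ 0 := by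
    rw [Matrix.det_smul, Matrix.det_one, mul_one]
    exact pow_ne_zero _ (by exact_mod_cast hb.ne')
  have hfac : ∀ i, χ i ᵥ* ((b : ℤ) • (1 : Matrix (Fin d) (Fin d) ℤ)) = (b : ℤ) • χ i := by
    intro i
    rw [Matrix.vecMul_smul, Matrix.vecMul_one]
  have hpairQ : ∀ U : Fin d → ℂ,
      (fun k => pair (((b : ℤ) • (1 : Matrix (Fin d) (Fin d) ℤ)) k) U) = (b : ℂ) • U := by
    intro U
    ext k
    simp [pair, Matrix.one_apply]
  refine ⟨(b : ℤ) • 1, hdet, ?_⟩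
  rintro W ⟨p, hp, rfl⟩
  have hp' := mem_hypInter.1 hp
  obtain ⟨q, hqt, hqp⟩ := exists_cover_eq hdet hp'.1
  have hq : ∀ i ∈ A, q ∈ preHyp χ ((b : ℤ) • 1) i := fun i hi =>
    mem_preHyp.2 ⟨hqt, by rw [hqp, hp'.2 i hi]⟩
  refine ⟨fun _ => q, hq, ?_⟩
  have hlift : ∀ i ∈ A, liftHyp χ ((b : ℤ) • 1) i q =
      {u | u ∈ torus d ∧ chr (χ i) u = chr (χ i) q} := by
    intro i hi
    obtain ⟨w, hw⟩ := (hprim i).exists_dotProduct_eq_one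
    exact liftHyp_of_factor hb (hfac i) hw (hq i hi)
  rw [connectedComponentIn_hypInter hp]
  ext x
  constructor
  · rintro ⟨u, ⟨hu, huA⟩, rfl⟩
    obtain ⟨U, rfl⟩ := exists_eq_mul_exps hu hqt
    have hm : ∀ i ∈ A, ∃ m : ℤ, pair (χ i) U = m * (2 * Real.pi * I) := by
      intro i hi
      have h1 := Set.mem_iInter₂.1 huA i hi
      rw [hlift i hi] at h1
      have h2 := h1.2
      rwa [chr_mul_exps, mul_eq_left₀ (chr_ne_zero _ hqt), exp_eq_one_iff] at h2
    choose! m hm using hm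
    refine ⟨(b : ℂ) • U + (2 * Real.pi * I : ℂ) • fun k => ((-∑ i ∈ A, m i • w i) k : ℂ),
      fun i hi => ?_, ?_⟩
    · rw [pair_add, pair_smul, pair_smul, pair_intCast, dotProduct_neg, dotProduct_sum, hm i hi,
        Finset.sum_eq_single i]
      · rw [dotProduct_smul, hw i hi i hi, if_pos rfl]
        push_cast
        simp
        ring
      · intro k hk hki
        rw [dotProduct_smul, hw i hi k hk, if_neg hki.symm, smul_zero]
      · exact fun h => absurd hi h
    · rw [exps_add, exps_two_pi, mul_one, cover_mul, hqp, cover_exps, hpairQ]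
  · rintro ⟨Y, hY, rfl⟩
    refine ⟨q * exps ((b : ℂ)⁻¹ • Y), ⟨mul_mem_torus hqt (exps_mem_torus _),
      Set.mem_iInter₂.2 fun i hi => ?_⟩, ?_⟩
    · rw [hlift i hi]
      exact ⟨mul_mem_torus hqt (exps_mem_torus _), by
        rw [chr_mul_exps, pair_smul, hY i hi, mul_zero, exp_zero, mul_one]⟩
    · rw [cover_mul, hqp, cover_exps, hpairQ, smul_smul, mul_inv_cancel₀ hb0, one_smul]

end Components

/-! ### Logarithmic forms -/

section Forms

open Complex

variable {d : ℕ}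

/-- The cotangent vector `d log e^ξ`. -/
def logCovector (ξ : Fin d → ℤ) (x : Fin d → ℂ) : Module.Dual ℂ (Fin d → ℂ) :=
  ∑ k, ((ξ k : ℂ) / x k) • LinearMap.proj k

theorem logCovector_apply (ξ : Fin d → ℤ) (x y : Fin d → ℂ) :
    logCovector ξ x y = ∑ k, (ξ k : ℂ) / x k * y k := by
  simp [logCovector]

theorem hasFDerivAt_chr (ξ : Fin d → ℤ) {x : Fin d → ℂ} (hx : x ∈ torus d) :
    HasFDerivAt (chr ξ) (chr ξ x • LinearMap.toContinuousLinearMap (logCovector ξ x)) x := by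
  have h1 : ∀ k ∈ Finset.univ, HasFDerivAt (fun y : Fin d → ℂ => y k ^ ξ k)
      (((ξ k : ℂ) * x k ^ (ξ k - 1)) • ContinuousLinearMap.proj (R := ℂ) (φ := fun _ => ℂ) k) x := by
    intro k _
    exact HasDerivAt.comp_hasFDerivAt (h₂ := fun z : ℂ => z ^ ξ k) x
      (hasDerivAt_zpow (ξ k) (x k) (Or.inl (hx k)))
      (ContinuousLinearMap.proj (R := ℂ) (φ := fun _ => ℂ) k).hasFDerivAt
  have h2 := HasFDerivAt.finsetProd h1
  refine h2.congr_fderiv ?_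
  ext y
  simp only [_root_.sum_apply, _root_.smul_apply,
    ContinuousLinearMap.proj_apply, smul_eq_mul, LinearMap.coe_toContinuousLinearMap',
    logCovector_apply, Finset.mul_sum]
  refine Finset.sum_congr rfl fun k hk => ?_
  rw [chr, ← Finset.mul_prod_erase _ _ hk, zpow_sub_one₀ (hx k)]
  ring

theorem dlog_chr (ξ : Fin d → ℤ) {x : Fin d → ℂ} (hx : x ∈ torus d) :
    dlog (chr ξ) x = ExteriorAlgebra.ι ℂ (logCovector ξ x) := by
  rw [dlog, (hasFDerivAt_chr ξ hx).fderiv, ← map_smul]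
  congr 1
  ext y
  simp [chr_ne_zero ξ hx]

theorem psiOne_eq (ξ : Fin d → ℤ) {x : Fin d → ℂ} (hx : x ∈ torus d) :
    psiOne ξ x = (2 * (Real.pi : ℂ) * I)⁻¹ • ExteriorAlgebra.ι ℂ (logCovector ξ x) := by
  rw [psiOne, dlog_chr ξ hx]

/-- For y = e^ξ / e^ξ(q) one has d log(1 - y) = y / (y - 1) d log y, and 2y / (y - 1) - 1 = (y + 1)
/ (y - 1). -/
theorem omegaBarOne_eq (ξ : Fin d → ℤ) {q u : Fin d → ℂ} (hq : q ∈ torus d) (hu : u ∈ torus d)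
    (h : chr ξ u ≠ chr ξ q) :
    omegaBarOne ξ q u = cay (chr ξ u / chr ξ q) • psiOne ξ u := by
  have hq0 := chr_ne_zero ξ hq
  have hy : chr ξ u / chr ξ q - 1 ≠ 0 := by
    rw [Ne, sub_eq_zero, div_eq_one_iff_eq hq0]
    exact h
  have hy' : 1 - chr ξ u / chr ξ q ≠ 0 := by
    rw [← neg_sub]
    exact neg_ne_zero.2 hy
  have h1 : HasFDerivAt (fun y => 1 - chr ξ y / chr ξ q)
      (-((chr ξ q)⁻¹ • (chr ξ u • LinearMap.toContinuousLinearMap (logCovector ξ u)))) u := by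
    have h2 := ((hasFDerivAt_chr ξ hu).const_mul (chr ξ q)⁻¹).const_sub 1
    simpa only [div_eq_inv_mul] using h2
  have h3 : dlog (fun y => 1 - chr ξ y / chr ξ q) u =
      ((chr ξ u / chr ξ q) / (chr ξ u / chr ξ q - 1)) • dlog (chr ξ) u := by
    rw [dlog, h1.fderiv, dlog_chr ξ hu, ← LinearMap.map_smul (ExteriorAlgebra.ι ℂ),
      ← LinearMap.map_smul (ExteriorAlgebra.ι ℂ)]
    refine congrArg (ExteriorAlgebra.ι ℂ (M := Module.Dual ℂ (Fin d → ℂ))) (LinearMap.ext fun y => ?_)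
    simp only [LinearMap.smul_apply, ContinuousLinearMap.coe_coe, _root_.neg_apply,
      _root_.smul_apply, LinearMap.coe_toContinuousLinearMap', smul_eq_mul]
    rw [← neg_sub (chr ξ u / chr ξ q) 1, inv_neg]
    ring
  rw [omegaBarOne, omegaOne, psiOne, h3, smul_smul, smul_smul, smul_smul, ← sub_smul]
  congr 1
  rw [cay]
  have h4 : (chr ξ u / chr ξ q + 1) / (chr ξ u / chr ξ q - 1) =
      2 * ((chr ξ u / chr ξ q) / (chr ξ u / chr ξ q - 1)) - 1 := by
    rw [eq_sub_iff_add_eq, ← mul_div_assoc, div_add_one hy]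
    ring
  rw [h4]
  ring

theorem psiOne_mul_psiOne (x : Fin d → ℂ) (hx : x ∈ torus d) (ξ ξ' : Fin d → ℤ) :
    psiOne ξ x * psiOne ξ' x = -(psiOne ξ' x * psiOne ξ x) := by
  rw [psiOne_eq ξ hx, psiOne_eq ξ' hx, smul_mul_smul_comm, smul_mul_smul_comm, ← smul_neg]
  congr 1
  exact eq_neg_of_add_eq_zero_left (ExteriorAlgebra.ι_add_mul_swap _ _)

theorem psiOne_sq (x : Fin d → ℂ) (hx : x ∈ torus d) (ξ : Fin d → ℤ) :
    psiOne ξ x * psiOne ξ x = 0 := by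
  rw [psiOne_eq ξ hx, smul_mul_smul_comm, ExteriorAlgebra.ι_sq_zero, smul_zero]

theorem psiOne_zsmul (m : ℤ) (ξ : Fin d → ℤ) {x : Fin d → ℂ} (hx : x ∈ torus d) :
    psiOne (m • ξ) x = (m : ℂ) • psiOne ξ x := by
  rw [psiOne_eq _ hx, psiOne_eq _ hx, smul_comm,
    ← LinearMap.map_smul (ExteriorAlgebra.ι ℂ) (m : ℂ)]
  congr 1
  refine congrArg (ExteriorAlgebra.ι ℂ (M := Module.Dual ℂ (Fin d → ℂ))) (LinearMap.ext fun y => ?_)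
  rw [LinearMap.smul_apply, logCovector_apply, logCovector_apply]
  simp [Finset.mul_sum, mul_div_assoc, mul_assoc]

theorem sum_zsmul_psiOne {ι : Type*} (s : Finset ι) (n : ι → ℤ) (ξ : ι → Fin d → ℤ)
    {x : Fin d → ℂ} (hx : x ∈ torus d) (h : ∑ i ∈ s, n i • ξ i = 0) :
    ∑ i ∈ s, (n i : ℂ) • psiOne (ξ i) x = 0 := by
  have h1 : ∑ i ∈ s, (n i : ℂ) • logCovector (ξ i) x = 0 := by
    ext k
    have hk := congrFun h k
    simp only [Finset.sum_apply, Pi.smul_apply, smul_eq_mul, Pi.zero_apply] at hk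
    simp only [LinearMap.coe_comp, Function.comp_apply, LinearMap.sum_apply, LinearMap.smul_apply,
      logCovector_apply, LinearMap.single_apply, smul_eq_mul, LinearMap.zero_apply,
      Pi.single_apply, mul_ite, mul_one, mul_zero, Finset.sum_ite_eq', Finset.mem_univ, if_true]
    simp only [← mul_div_assoc, ← Finset.sum_div]
    rw [show ∑ i ∈ s, (n i : ℂ) * (ξ i k : ℂ) = ((∑ i ∈ s, n i * ξ i k : ℤ) : ℂ) by push_cast; rfl,
      hk]
    simp
  simp only [psiOne_eq _ hx, smul_comm _ (2 * (Real.pi : ℂ) * I)⁻¹, ← Finset.smul_sum, ← map_smul,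
    ← map_sum, h1, map_zero, smul_zero]

/-! ### Pull-back along a covering -/

variable {P : Matrix (Fin d) (Fin d) ℤ}

theorem fderiv_cover_apply {u : Fin d → ℂ} (hu : u ∈ torus d) (y : Fin d → ℂ) (k : Fin d) :
    fderiv ℂ (cover P) u y k = cover P u k * logCovector (P k) u y := by
  have h1 : HasFDerivAt (cover P) (ContinuousLinearMap.pi fun k =>
      chr (P k) u • LinearMap.toContinuousLinearMap (logCovector (P k) u)) u :=
    hasFDerivAt_pi.2 fun k => hasFDerivAt_chr (P k) hu
  rw [h1.fderiv]
  simp [cover]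

theorem map_psiOne (ξ : Fin d → ℤ) {u : Fin d → ℂ} (hu : u ∈ torus d) :
    ExteriorAlgebra.map
      (LinearMap.dualMap (fderiv ℂ (cover P) u : (Fin d → ℂ) →ₗ[ℂ] (Fin d → ℂ)))
      (psiOne ξ (cover P u)) = psiOne (ξ ᵥ* P) u := by
  rw [psiOne_eq _ (cover_mem_torus hu), psiOne_eq _ hu, map_smul, ExteriorAlgebra.map_apply_ι]
  congr 2
  ext1 k
  ext
  simp only [LinearMap.coe_comp, Function.comp_apply, LinearMap.dualMap_apply,
    ContinuousLinearMap.coe_coe]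
  set y : Fin d → ℂ := LinearMap.single ℂ (fun _ => ℂ) k 1
  rw [logCovector_apply, logCovector_apply]
  simp only [fderiv_cover_apply hu, logCovector_apply]
  have h1 : ∀ k, (ξ k : ℂ) / cover P u k * (cover P u k * ∑ l, (P k l : ℂ) / u l * y l) =
      ∑ l, (ξ k : ℂ) * (P k l / u l * y l) := by
    intro k
    rw [← mul_assoc, div_mul_cancel₀ _ (cover_mem_torus hu k), Finset.mul_sum]
  simp only [h1]
  rw [Finset.sum_comm]
  refine Finset.sum_congr rfl fun l _ => ?_
  simp only [Matrix.vecMul, dotProduct, Int.cast_sum, Int.cast_mul, Finset.sum_div, Finset.sum_mul]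
  exact Finset.sum_congr rfl fun k _ => by ring

/-- The covering is étale; this is what makes a form on the complement determined by its pull-back.
-/
theorem map_fderiv_cover_injective (hP : P.det ≠ 0) {u : Fin d → ℂ} (hu : u ∈ torus d) :
    Function.Injective (ExteriorAlgebra.map
      (LinearMap.dualMap (fderiv ℂ (cover P) u : (Fin d → ℂ) →ₗ[ℂ] (Fin d → ℂ)))) := by
  refine ExteriorAlgebra.map_injective_field (LinearMap.ker_eq_bot.2 ?_)
  refine LinearMap.dualMap_injective_of_surjective fun y => ?_
  obtain ⟨U, hU⟩ := exists_pair_eq hP fun k => y k / cover P u k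
  refine ⟨u * U, funext fun k => ?_⟩
  rw [ContinuousLinearMap.coe_coe, fderiv_cover_apply hu, logCovector_apply]
  have h1 : ∑ l, (P k l : ℂ) / u l * (u * U) l = pair (P k) U := by
    refine Finset.sum_congr rfl fun l _ => ?_
    rw [Pi.mul_apply, ← mul_assoc, div_mul_cancel₀ _ (hu l)]
  rw [h1, congrFun hU k, mul_div_cancel₀ _ (cover_mem_torus hu k)]

end Forms

/-! ### Sums over the fibres of a covering -/

/-- Every fibre of Φ is a translate of the one through 0, so each value is taken equally often. -/
theorem sum_comp_eq_card_smul_finsum {G X M : Type*} [AddGroup G] [Fintype G] [AddCommMonoid M]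
    (Φ : G → X) (hΦ : ∀ v v' : G, Φ v = Φ v' ↔ Φ (v - v') = Φ 0) (F : X → M) :
    ∑ v, F (Φ v) = Nat.card {v // Φ v = Φ 0} • ∑ᶠ q ∈ Set.range Φ, F q := by
  classical
  have h1 : Set.range Φ = ((Finset.univ.image Φ : Finset X) : Set X) := by simp
  rw [h1, finsum_mem_coe_finset, Finset.sum_comp F Φ, Finset.smul_sum]
  refine Finset.sum_congr rfl fun q hq => ?_
  obtain ⟨v', _, rfl⟩ := Finset.mem_image.1 hq
  congr 1
  rw [Nat.card_eq_fintype_card, Fintype.card_subtype]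
  refine Finset.card_bij' (fun v _ => v - v') (fun v _ => v + v') ?_ ?_ ?_ ?_
  · intro v hv
    simpa using (hΦ v v').1 (Finset.mem_filter.1 hv).2
  · intro v hv
    simpa [hΦ (v + v') v'] using hv
  · intro v _
    simp
  · intro v _
    simp

section Fiber

open Complex

variable {d : ℕ} {P : Matrix (Fin d) (Fin d) ℤ}

/-- A multiple `R` of the determinant clears the denominators of the inverse matrix. -/
theorem exists_mul_eq_smul_one {R : ℕ} (hR : P.det ∣ (R : ℤ)) :
    ∃ P' : Matrix (Fin d) (Fin d) ℤ, P * P' = (R : ℤ) • 1 ∧ P' * P = (R : ℤ) • 1 := by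
  obtain ⟨c, hc⟩ := hR
  refine ⟨c • P.adjugate, ?_, ?_⟩
  · rw [Matrix.mul_smul, Matrix.mul_adjugate, smul_smul, hc, mul_comm]
  · rw [Matrix.smul_mul, Matrix.adjugate_mul, smul_smul, hc, mul_comm]

/-- The parametrisation of the fibre through `q₀` by cocharacters. -/
def fiberPoint (P' : Matrix (Fin d) (Fin d) ℤ) (R : ℕ) (q₀ : Fin d → ℂ) (v : Fin d → ℤ) :
    Fin d → ℂ :=
  q₀ * exps ((-(2 * Real.pi * I / R) : ℂ) • fun k => ((P' *ᵥ v) k : ℂ))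

variable {P' : Matrix (Fin d) (Fin d) ℤ} {R : ℕ} {q₀ p : Fin d → ℂ}

theorem fiberPoint_add (v w : Fin d → ℤ) :
    fiberPoint P' R q₀ (v + w) =
      fiberPoint P' R q₀ v * exps ((-(2 * Real.pi * I / R) : ℂ) • fun k => ((P' *ᵥ w) k : ℂ)) := by
  rw [fiberPoint, fiberPoint, mul_assoc q₀, ← exps_add, ← smul_add]
  congr 3
  ext k
  simp [Matrix.mulVec_add]

theorem fiberPoint_zero : fiberPoint P' R q₀ 0 = q₀ := by
  have : ((-(2 * Real.pi * I / R) : ℂ) • fun k => ((P' *ᵥ (0 : Fin d → ℤ)) k : ℂ)) = 0 := by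
    ext k
    simp
  rw [fiberPoint, this, exps_zero, mul_one]

theorem fiberPoint_mem_torus (hq : q₀ ∈ torus d) (v : Fin d → ℤ) :
    fiberPoint P' R q₀ v ∈ torus d :=
  mul_mem_torus hq (exps_mem_torus _)

variable [NeZero R]

theorem fiberPoint_congr {v w : Fin d → ℤ} (h : ∀ k, (v k : ZMod R) = w k) :
    fiberPoint P' R q₀ v = fiberPoint P' R q₀ w := by
  have hR : (R : ℂ) ≠ 0 := by exact_mod_cast NeZero.ne R
  have hd : ∀ k, (R : ℤ) ∣ v k - w k := fun k =>
    (ZMod.intCast_eq_intCast_iff_dvd_sub _ _ _).1 (h k).symm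
  choose c hc using hd
  have hv : v = w + (R : ℤ) • c := by
    ext k
    have := hc k
    simp only [Pi.add_apply, Pi.smul_apply, smul_eq_mul]
    linarith
  rw [hv, fiberPoint_add]
  have h1 : ((-(2 * Real.pi * I / R) : ℂ) • fun k => ((P' *ᵥ ((R : ℤ) • c)) k : ℂ)) =
      (2 * Real.pi * I : ℂ) • fun k => ((-(P' *ᵥ c)) k : ℂ) := by
    ext k
    simp only [Matrix.mulVec_smul, Pi.smul_apply, Pi.neg_apply, smul_eq_mul]
    push_cast
    field_simp
  rw [h1, exps_two_pi, mul_one]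

theorem pair_mulVec (ξ : Fin d → ℤ) (v : Fin d → ℤ) :
    pair ξ (fun k => ((P' *ᵥ v) k : ℂ)) = ((ξ ᵥ* P') ⬝ᵥ v : ℤ) := by
  rw [pair_intCast, Matrix.dotProduct_mulVec]

theorem range_fiberPoint (h1 : P * P' = (R : ℤ) • 1) (h2 : P' * P = (R : ℤ) • 1)
    (hp : p ∈ torus d) (hq : q₀ ∈ fiber P p) :
    Set.range (fun v : Fin d → ZMod R => fiberPoint P' R q₀ (zlift v)) = fiber P p := by
  have hR : (R : ℂ) ≠ 0 := by exact_mod_cast NeZero.ne R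
  ext q
  constructor
  · rintro ⟨v, rfl⟩
    refine ⟨fiberPoint_mem_torus hq.1 _, ?_⟩
    have h3 : (fun k => pair (P k) ((-(2 * Real.pi * I / R) : ℂ) •
        fun k => ((P' *ᵥ zlift v) k : ℂ))) =
        (2 * Real.pi * I : ℂ) • fun k => ((-zlift v) k : ℂ) := by
      ext k
      rw [pair_smul, pair_intCast]
      have h4 : P k ⬝ᵥ P' *ᵥ zlift v = R * zlift v k := by
        have : (P *ᵥ (P' *ᵥ zlift v)) k = ((R : ℤ) • zlift v) k := by
          rw [Matrix.mulVec_mulVec, h1, Matrix.smul_mulVec, Matrix.one_mulVec]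
        exact this
      rw [h4]
      simp only [Pi.smul_apply, Pi.neg_apply, smul_eq_mul]
      push_cast
      field_simp
    change cover P (q₀ * exps _) = p
    rw [cover_mul, cover_exps, h3, exps_two_pi, mul_one, hq.2]
  · rintro ⟨hqt, hqp⟩
    obtain ⟨U, rfl⟩ := exists_eq_mul_exps hqt hq.1
    rw [cover_mul, hq.2, cover_exps] at hqp
    have h3 : exps (fun k => pair (P k) U) = exps 0 := by
      refine mul_exps_cancel hp ?_
      rw [hqp, exps_zero, mul_one]
    obtain ⟨w, hw⟩ := exps_eq_exps_iff.1 h3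
    rw [zero_add] at hw
    -- From P U = 2π√-1 w and P' P = R follows R U = 2π√-1 P' w; the sign matches the minus in
    -- `fiberPoint`.
    refine ⟨fun k => ((-w) k : ℤ), ?_⟩
    change fiberPoint P' R q₀ _ = _
    rw [fiberPoint_congr (w := -w) fun k => intCast_zlift _ k, fiberPoint]
    congr 2
    ext l
    have h4 : ((P' *ᵥ w) l : ℂ) * (2 * Real.pi * I) = R * U l := by
      have h5 : ∀ k, (w k : ℂ) * (2 * Real.pi * I) = pair (P k) U := fun k => by
        rw [congrFun hw k, Pi.smul_apply, smul_eq_mul, mul_comm]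
      have h6 : ∀ m, (∑ k, P' l k * P k m : ℤ) = if l = m then (R : ℤ) else 0 := fun m => by
        have := congrFun (congrFun h2 l) m
        rw [Matrix.mul_apply] at this
        rw [this]
        simp [Matrix.one_apply]
      simp only [Matrix.mulVec, dotProduct, Int.cast_sum, Int.cast_mul, Finset.sum_mul, mul_assoc]
      simp only [mul_assoc] at h5
      simp only [h5, pair, Finset.mul_sum]
      rw [Finset.sum_comm]
      simp only [← mul_assoc, ← Finset.sum_mul]
      have h7 : ∀ m, (∑ k, (P' l k : ℂ) * (P k m : ℂ)) = if l = m then (R : ℂ) else 0 := fun m => by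
        have := congrArg (Int.cast : ℤ → ℂ) (h6 m)
        push_cast at this
        exact this
      simp [h7]
    simp only [Pi.smul_apply, smul_eq_mul, Matrix.mulVec_neg, Pi.neg_apply, Int.cast_neg]
    field_simp
    linear_combination h4

theorem fiberPoint_zlift_eq_iff (v v' : Fin d → ZMod R) :
    fiberPoint P' R q₀ (zlift v) = fiberPoint P' R q₀ (zlift v') ↔
      fiberPoint P' R q₀ (zlift (v - v')) = fiberPoint P' R q₀ (zlift (0 : Fin d → ZMod R)) := by
  have h1 : fiberPoint P' R q₀ (zlift v) =
      fiberPoint P' R q₀ (zlift (v - v')) *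
        exps ((-(2 * Real.pi * I / R) : ℂ) • fun k => ((P' *ᵥ zlift v') k : ℂ)) := by
    rw [← fiberPoint_add]
    refine fiberPoint_congr fun k => ?_
    simp only [Pi.add_apply, Int.cast_add, intCast_zlift, Pi.sub_apply, sub_add_cancel]
  have h0 : fiberPoint P' R q₀ (zlift (0 : Fin d → ZMod R)) = q₀ := by
    rw [fiberPoint_congr (w := 0) fun k => by rw [intCast_zlift]; simp, fiberPoint_zero]
  have h2 : fiberPoint P' R q₀ (zlift v') =
      q₀ * exps ((-(2 * Real.pi * I / R) : ℂ) • fun k => ((P' *ᵥ zlift v') k : ℂ)) := rfl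
  rw [h1, h0, h2]
  exact ⟨fun h => funext fun k => mul_right_cancel₀ (exps_mem_torus _ k) (congrFun h k),
    fun h => by rw [h]⟩

end Fiber

/-! ### The forms attached to a separating covering -/

section OmegaBar

open Complex

variable {E : Type*} {d : ℕ} {χ : E → Fin d → ℤ} {P : Matrix (Fin d) (Fin d) ℤ}
  {P' : Matrix (Fin d) (Fin d) ℤ} {R : ℕ} [NeZero R] {q₀ p : Fin d → ℂ}

/-- P' inverts P up to R, so χ̂_i / a_i evaluates on P' v / R to χ_i(v) / a_i. The minus sign
becomes a plus in the ratio of values at u and at q, as in `logArg`. -/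
theorem chr_liftChar_fiberPoint {i : E} (hi : IsPrimitive (χ i)) (hP : P.det ≠ 0)
    (h1 : P * P' = (R : ℤ) • 1) (v : Fin d → ℤ) :
    chr (liftChar χ P i) (fiberPoint P' R q₀ v) =
      chr (liftChar χ P i) q₀ *
        exp (-(2 * Real.pi * I * (χ i ⬝ᵥ v : ℤ) / numComp χ P i)) := by
  have hR : (R : ℂ) ≠ 0 := by exact_mod_cast NeZero.ne R
  have ha : (numComp χ P i : ℂ) ≠ 0 := by exact_mod_cast (numComp_pos hi hP).ne'
  have h2 : (numComp χ P i : ℤ) * ((liftChar χ P i ᵥ* P') ⬝ᵥ v) = R * (χ i ⬝ᵥ v) := by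
    rw [← smul_eq_mul, ← smul_dotProduct, ← Matrix.smul_vecMul, ← vecMul_eq_numComp_smul hi hP,
      Matrix.vecMul_vecMul, h1, Matrix.vecMul_smul, Matrix.vecMul_one, smul_dotProduct, smul_eq_mul]
  have h3 : (numComp χ P i : ℂ) * (((liftChar χ P i ᵥ* P') ⬝ᵥ v : ℤ) : ℂ) =
      R * ((χ i ⬝ᵥ v : ℤ) : ℂ) := by exact_mod_cast congrArg (Int.cast : ℤ → ℂ) h2
  rw [fiberPoint, chr_mul_exps, pair_smul, pair_mulVec]
  congr 2
  rw [neg_mul]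
  congr 1
  field_simp
  linear_combination h3

theorem chr_liftChar_fiberPoint_eq_iff {i : E} (hi : IsPrimitive (χ i)) (hP : P.det ≠ 0)
    (h1 : P * P' = (R : ℤ) • 1) (hq : q₀ ∈ torus d) (v : Fin d → ℤ) :
    chr (liftChar χ P i) (fiberPoint P' R q₀ v) = chr (liftChar χ P i) q₀ ↔
      (numComp χ P i : ℤ) ∣ χ i ⬝ᵥ v := by
  have ha : (numComp χ P i : ℂ) ≠ 0 := by exact_mod_cast (numComp_pos hi hP).ne'
  rw [chr_liftChar_fiberPoint hi hP h1, mul_eq_left₀ (chr_ne_zero _ hq), exp_neg, inv_eq_one,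
    exp_eq_one_iff]
  have hpi : (2 * Real.pi * I : ℂ) ≠ 0 := two_pi_I_ne_zero
  constructor
  · rintro ⟨m, hm⟩
    refine ⟨m, ?_⟩
    rw [div_eq_iff ha] at hm
    have : ((χ i ⬝ᵥ v : ℤ) : ℂ) = numComp χ P i * m := by
      apply mul_left_cancel₀ hpi
      linear_combination hm
    exact_mod_cast this
  · rintro ⟨m, hm⟩
    refine ⟨m, ?_⟩
    rw [hm, div_eq_iff ha]
    push_cast
    ring

theorem pullback_injective (hP : P.det ≠ 0) :
    Function.Injective (pullback χ P) := by
  intro θ θ' h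
  ext1 x
  obtain ⟨u, hu, hux⟩ := exists_cover_eq hP x.2.1
  have hu' : u ∈ liftCompl χ P := ⟨hu, by
    change cover P u ∈ arrCompl χ
    rw [hux]
    exact x.2⟩
  have h1 := congrFun h ⟨u, hu'⟩
  have h2 := map_fderiv_cover_injective hP hu h1
  have h3 : (⟨cover P u, hu'.2⟩ : arrCompl χ) = x := Subtype.ext hux
  rwa [h3] at h2

theorem cothSum_sub {a : E → ℕ} {A : Finset E} {X Y : Fin d → ℂ}
    (hY : ∀ i ∈ A, pair (χ i) Y = 0) : cothSum χ a R A (X - Y) = cothSum χ a R A X := by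
  refine Finset.sum_congr rfl fun v _ => Finset.prod_congr rfl fun i hi => ?_
  rw [logArg, logArg, pair_sub, hY i hi, sub_zero]

variable [LinearOrder E]

theorem liftOmegaBar_fiberPoint (hprim : ∀ i, IsPrimitive (χ i)) (hP : P.det ≠ 0)
    (h1 : P * P' = (R : ℤ) • 1) {A : Finset E} (hp : p ∈ hypInter χ A) (hq : q₀ ∈ fiber P p)
    (u : liftCompl χ P) {U : Fin d → ℂ} (hU : (u : Fin d → ℂ) = q₀ * exps U) (v : Fin d → ℤ) :
    liftOmegaBar χ P A (fiberPoint P' R q₀ v) u =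
      (cothProd χ (numComp χ P) A (fun k => pair (P k) U) v * ∏ i ∈ A, (numComp χ P i : ℂ)⁻¹) •
        orderedProd A (fun i => psiOne (χ i ᵥ* P) u) := by
  have hqt := hq.1
  have hp' := mem_hypInter.1 hp
  have key : ∀ i ∈ A, omegaBarOne (liftChar χ P i) (fiberPoint P' R q₀ v) u =
      (cay (exp (logArg χ (numComp χ P) (fun k => pair (P k) U) v i)) * (numComp χ P i : ℂ)⁻¹) •
        psiOne (χ i ᵥ* P) u := by
    intro i hi
    have ha : (numComp χ P i : ℂ) ≠ 0 := by exact_mod_cast (numComp_pos (hprim i) hP).ne'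
    have hpow : ∀ {y : Fin d → ℂ}, y ∈ torus d →
        chr (liftChar χ P i) y ^ numComp χ P i = chr (χ i) (cover P y) := by
      intro y hy
      rw [← chr_nsmul, ← vecMul_eq_numComp_smul (hprim i) hP, chr_cover _ hy]
    have hqv := fiberPoint_mem_torus (P' := P') (R := R) hqt v
    -- Otherwise the a_i-th power would give e^{χ_i} = 1 at the image of u, which lies off the
    -- arrangement.
    have hne : chr (liftChar χ P i) u ≠ chr (liftChar χ P i) (fiberPoint P' R q₀ v) := by
      intro h
      have h2 := hpow u.2.1
      have h3 := hpow hqt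
      rw [hq.2, hp'.2 i hi] at h3
      rw [h, chr_liftChar_fiberPoint (hprim i) hP h1, mul_pow, h3, one_mul, ← exp_nat_mul,
        mul_neg, mul_div_cancel₀ _ ha, exp_neg,
        show (2 * Real.pi * I * (χ i ⬝ᵥ v : ℤ) : ℂ) = (χ i ⬝ᵥ v : ℤ) * (2 * Real.pi * I) by ring,
        exp_int_mul_two_pi_mul_I, inv_one] at h2
      exact u.2.2.2 (Set.mem_iUnion.2 ⟨i, cover_mem_torus u.2.1, h2.symm⟩)
    rw [omegaBarOne_eq _ hqv u.2.1 hne, vecMul_eq_numComp_smul (hprim i) hP,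
      psiOne_zsmul _ _ u.2.1, smul_smul, Int.cast_natCast, mul_assoc, inv_mul_cancel₀ ha, mul_one]
    congr 2
    rw [chr_liftChar_fiberPoint (hprim i) hP h1, hU, chr_mul_exps,
      mul_div_mul_left _ _ (chr_ne_zero _ hqt), ← exp_sub, logArg,
      ← numComp_mul_pair_liftChar (hprim i) hP]
    congr 1
    field_simp
    ring
  rw [liftOmegaBar, orderedProd_congr key, orderedProd_smul, Finset.prod_mul_distrib]
  rfl

/-- The right-hand side of the defining property of `ω̄_{W,A}`, in terms of hyperbolic
cotangents. -/
theorem fiber_sum_eq (hprim : ∀ i, IsPrimitive (χ i)) (hP : P.det ≠ 0) {A : Finset E}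
    (hA : LinearIndepOn ℚ (ratChar χ) (A : Set E)) (hs : Separates χ P A)
    (hR : P.det ∣ (R : ℤ)) (haR : ∀ i ∈ A, numComp χ P i ∣ R)
    (hp : p ∈ hypInter χ A) (hq : q₀ ∈ fiber P p)
    (u : liftCompl χ P) {X : Fin d → ℂ} (hX : cover P u = p * exps X) :
    ((((torus d ∩ ⋂ i ∈ A, liftHyp χ P i q₀) ∩ fiber P p).ncard : ℂ)⁻¹ •
      ∑ᶠ q ∈ fiber P p, liftOmegaBar χ P A q) u =
    ((mult χ A : ℂ) * R ^ d)⁻¹ • cothSum χ (numComp χ P) R A X •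
        orderedProd A (fun i => psiOne (χ i ᵥ* P) u) := by
  classical
  have hp' := mem_hypInter.1 hp
  obtain ⟨P', h1, h2⟩ := exists_mul_eq_smul_one hR
  have hrange := range_fiberPoint h1 h2 hp'.1 hq
  set Φ : (Fin d → ZMod R) → Fin d → ℂ := fun v => fiberPoint P' R q₀ (zlift v) with hΦdef
  have hΦ := fiberPoint_zlift_eq_iff (P' := P') (R := R) (q₀ := q₀)
  set K := Nat.card {v // Φ v = Φ 0} with hK
  have hK0 : (K : ℂ) ≠ 0 := by
    have : Nonempty {v // Φ v = Φ 0} := ⟨⟨0, rfl⟩⟩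
    exact_mod_cast Nat.card_pos.ne'
  set S := torus d ∩ ⋂ i ∈ A, liftHyp χ P i q₀ with hS
  have hmemS : ∀ v, Φ v ∈ S ↔ ∀ i ∈ A, (numComp χ P i : ℤ) ∣ χ i ⬝ᵥ zlift v := by
    intro v
    have hv : Φ v ∈ torus d := fiberPoint_mem_torus hq.1 _
    rw [hS, Set.mem_inter_iff, Set.mem_iInter₂, and_iff_right hv]
    refine forall₂_congr fun i hi => ?_
    rw [liftHyp_eq (hprim i) hP (mem_preHyp.2 ⟨hq.1, by rw [hq.2, hp'.2 i hi]⟩),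
      ← chr_liftChar_fiberPoint_eq_iff (hprim i) hP h1 hq.1]
    exact and_iff_right hv
  set D := Nat.card {v : Fin d → ZMod R // ∀ i ∈ A, (numComp χ P i : ℤ) ∣ χ i ⬝ᵥ zlift v} with hD
  -- D counts the parameters of fibre points on the lifted layer. Each such point has K parameters,
  -- as in `hsum`, so K cancels in the normalised sum.
  have hcount : (D : ℂ) = K * ((S ∩ fiber P p).ncard : ℂ) := by
    have h3 := sum_comp_eq_card_smul_finsum Φ hΦ (fun q => if q ∈ S then (1 : ℂ) else 0)
    have h4 : Set.range Φ = ((Finset.univ.image Φ : Finset (Fin d → ℂ)) : Set (Fin d → ℂ)) := by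
      simp
    have h5 : S ∩ fiber P p =
        (((Finset.univ.image Φ).filter (· ∈ S) : Finset (Fin d → ℂ)) : Set (Fin d → ℂ)) := by
      rw [← hrange, h4, Finset.coe_filter, Set.inter_comm]
      rfl
    rw [h4, finsum_mem_coe_finset, Finset.sum_boole, Finset.sum_boole, nsmul_eq_mul] at h3
    rw [h5, Set.ncard_coe_finset, ← h3, hD, Nat.card_eq_fintype_card, Fintype.card_subtype]
    simp only [hmemS]
  have hsum : (K : ℂ) • (∑ᶠ q ∈ fiber P p, liftOmegaBar χ P A q) u =
      ∑ v, liftOmegaBar χ P A (Φ v) u := by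
    have h3 := sum_comp_eq_card_smul_finsum Φ hΦ (fun q => liftOmegaBar χ P A q)
    rw [hrange] at h3
    have h4 := congrFun h3 u
    rw [Finset.sum_apply, Pi.smul_apply] at h4
    rw [h4, Nat.cast_smul_eq_nsmul]
  -- Together with the factors a_i⁻¹ from the lifted characters, the normalisation thus becomes
  -- (m(A) R^d)⁻¹. Separation enters only here.
  have hcard : (D : ℂ) * ∏ i ∈ A, (numComp χ P i : ℂ) = mult χ A * R ^ d := by
    exact_mod_cast card_mul_prod_eq_mult hA haR (hs.exists_dotProduct_eq hprim hP hA)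
  obtain ⟨U, hU⟩ := exists_eq_mul_exps u.2.1 hq.1
  have hXU : cothSum χ (numComp χ P) R A X =
      cothSum χ (numComp χ P) R A (fun k => pair (P k) U) := by
    rw [hU, cover_mul, hq.2, cover_exps] at hX
    obtain ⟨w, hw⟩ := exps_eq_exps_iff.1 (mul_exps_cancel hp'.1 hX)
    rw [hw, cothSum_add_two_pi haR]
  have hterm : ∀ v, liftOmegaBar χ P A (Φ v) u = _ := fun v =>
    liftOmegaBar_fiberPoint hprim hP h1 hp hq u hU (zlift v)
  rw [Pi.smul_apply, ← hcard, hXU, cothSum]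
  simp only [hterm] at hsum
  rw [← Finset.sum_smul, ← Finset.sum_mul] at hsum
  have hsum' := congrArg (fun z => (K : ℂ)⁻¹ • z) hsum
  simp only [smul_smul, inv_mul_cancel₀ hK0, one_smul] at hsum'
  rw [hsum', smul_smul, smul_smul, hcount, Finset.prod_inv_distrib]
  congr 1
  simp only [mul_inv]
  ring

theorem pullback_smul_psiProd (c : arrCompl χ → ℂ) (A : Finset E) (u : liftCompl χ P) :
    pullback χ P (fun x => c x • psiProd χ A x) u =
      c ⟨cover P u, u.2.2⟩ • orderedProd A (fun i => psiOne (χ i ᵥ* P) u) := by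
  rw [pullback, map_smul, psiProd, map_orderedProd]
  congr 1
  exact orderedProd_congr fun i _ => map_psiOne (χ i) u.2.1

/-- Moving the base point p within its layer changes the logarithm by a vector killed by all χ_i, i
∈ A, which leaves the mean unchanged; so one formula satisfies the condition at every point of W. -/
theorem isOmegaBarVia_cothSum (hprim : ∀ i, IsPrimitive (χ i)) (hP : P.det ≠ 0) {A : Finset E}
    (hA : LinearIndepOn ℚ (ratChar χ) (A : Set E)) (hs : Separates χ P A)
    (hR : P.det ∣ (R : ℤ)) (haR : ∀ i ∈ A, numComp χ P i ∣ R) (hp : p ∈ hypInter χ A)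
    {lg : arrCompl χ → Fin d → ℂ} (hlg : ∀ x : arrCompl χ, (x : Fin d → ℂ) = p * exps (lg x)) :
    IsOmegaBarVia χ P A (connectedComponentIn (hypInter χ A) p) (fun x : arrCompl χ =>
      (((mult χ A : ℂ) * R ^ d)⁻¹ * cothSum χ (numComp χ P) R A (lg x)) • psiProd χ A x) := by
  have hpt := (mem_hypInter.1 hp).1
  intro p' hp' q₀ hq
  rw [connectedComponentIn_hypInter hp] at hp'
  obtain ⟨Y, hY, rfl⟩ := hp'
  have hp'' : p * exps Y ∈ hypInter χ A := by
    refine mem_hypInter.2 ⟨mul_mem_torus hpt (exps_mem_torus _), fun i hi => ?_⟩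
    rw [chr_mul_exps, hY i hi, exp_zero, mul_one, (mem_hypInter.1 hp).2 i hi]
  ext1 u
  have hXu : cover P u = (p * exps Y) * exps (lg ⟨cover P u, u.2.2⟩ - Y) := by
    rw [mul_assoc, ← exps_add, add_sub_cancel]
    exact hlg ⟨cover P u, u.2.2⟩
  refine Eq.trans ?_ (fiber_sum_eq hprim hP hA hs hR haR hp'' hq u hXu).symm
  rw [pullback_smul_psiProd, smul_smul, cothSum_sub hY]

theorem omegaBarVia_apply (hprim : ∀ i, IsPrimitive (χ i)) (hP : P.det ≠ 0) {A : Finset E}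
    (hA : LinearIndepOn ℚ (ratChar χ) (A : Set E)) (hs : Separates χ P A)
    (hR : P.det ∣ (R : ℤ)) (haR : ∀ i ∈ A, numComp χ P i ∣ R)
    (hp : p ∈ hypInter χ A) (x : arrCompl χ) {X : Fin d → ℂ} (hX : (x : Fin d → ℂ) = p * exps X) :
    omegaBarVia χ P A (connectedComponentIn (hypInter χ A) p) x =
      (((mult χ A : ℂ) * R ^ d)⁻¹ * cothSum χ (numComp χ P) R A X) • psiProd χ A x := by
  have hpt := (mem_hypInter.1 hp).1
  have hlog : ∀ x : arrCompl χ, ∃ X, (x : Fin d → ℂ) = p * exps X := fun x =>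
    exists_eq_mul_exps x.2.1 hpt
  choose lg hlg using hlog
  have hvia := isOmegaBarVia_cothSum hprim hP hA hs hR haR hp hlg
  have hspec : IsOmegaBarVia χ P A (connectedComponentIn (hypInter χ A) p)
      (omegaBarVia χ P A (connectedComponentIn (hypInter χ A) p)) :=
    Classical.epsilon_spec ⟨_, hvia⟩
  obtain ⟨q₀, hq₀, hq₀p⟩ := exists_cover_eq hP hpt
  have hmem := mem_connectedComponentIn hp
  -- The explicit form shows that the chosen form has the defining property; injectivity of the
  -- pull-back then identifies the two.
  have heq := pullback_injective hP
    ((hspec p hmem q₀ ⟨hq₀, hq₀p⟩).trans (hvia p hmem q₀ ⟨hq₀, hq₀p⟩).symm)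
  rw [heq]
  obtain ⟨w, hw⟩ := exps_eq_exps_iff.1 (mul_exps_cancel hpt ((hlg x).symm.trans hX))
  beta_reduce
  rw [hw, cothSum_add_two_pi haR]

end OmegaBar

/-! ### The relation attached to a circuit -/

section Relation

open Complex

variable {E : Type*} {d : ℕ} {χ : E → Fin d → ℤ}

theorem cay_add_one {y : ℂ} (hy : y ≠ 1) : cay y + 1 = y * (cay y - 1) := by
  have h : y - 1 ≠ 0 := sub_ne_zero.2 hy
  rw [cay]
  field_simp
  ring

theorem prod_cay_add_one {C : Finset E} {y : E → ℂ} (hy : ∀ i ∈ C, y i ≠ 1)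
    (hprod : ∏ i ∈ C, y i = 1) : ∏ i ∈ C, (cay (y i) + 1) = ∏ i ∈ C, (cay (y i) - 1) := by
  rw [Finset.prod_congr rfl fun i hi => cay_add_one (hy i hi), Finset.prod_mul_distrib, hprod,
    one_mul]

theorem exp_logArg_ne_one {a : E → ℕ} {i : E} (ha : a i ≠ 0) {X : Fin d → ℂ} (v : Fin d → ℤ)
    (hX : exp (pair (χ i) X) ≠ 1) : exp (logArg χ a X v i) ≠ 1 := by
  intro h
  apply hX
  have h2 : exp ((a i : ℂ) * logArg χ a X v i) = 1 := by rw [exp_nat_mul, h, one_pow]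
  rwa [logArg, mul_div_cancel₀ _ (by exact_mod_cast ha), exp_add,
    show (2 * Real.pi * I * (χ i ⬝ᵥ v : ℤ) : ℂ) = (χ i ⬝ᵥ v : ℤ) * (2 * Real.pi * I) by ring,
    exp_int_mul_two_pi_mul_I, mul_one] at h2

theorem intCast_eq_sign_mul_natAbs (m : ℤ) : (m : ℂ) = m.sign * (m.natAbs : ℂ) := by
  conv_lhs => rw [← Int.sign_mul_natAbs m]
  rw [Int.cast_mul, Int.cast_natCast]

theorem sign_mul_cay {m : ℤ} (hm : m ≠ 0) (z : ℂ) :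
    (m.sign : ℂ) * cay (exp z) = cay (exp (m.sign * z)) := by
  rcases lt_or_gt_of_ne hm with h | h
  · rw [Int.sign_eq_neg_one_of_neg h]
    push_cast
    rw [neg_one_mul, neg_one_mul, exp_neg, cay_inv (exp_ne_zero z)]
  · rw [Int.sign_eq_one_of_pos h]
    simp

/-- The relation between products of hyperbolic cotangents of a family of arguments that satisfies
a linear relation. -/
theorem sum_odd_sign_cothProd_eq_zero [Fintype E] [DecidableEq E] {C : Finset E} {n : E → ℤ}
    (hn : ∑ i ∈ C, n i • χ i = 0) (hn0 : ∀ i ∈ C, n i ≠ 0) {a : E → ℕ} {D : ℕ} (hD : D ≠ 0)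
    (ha : ∀ i ∈ C, a i * (n i).natAbs = D) {X : Fin d → ℂ}
    (hX : ∀ i, exp (pair (χ i) X) ≠ 1) (v : Fin d → ℤ) :
    ∑ B ∈ C.powerset with Odd B.card,
      (∏ i ∈ B, ((n i).sign : ℂ)) * cothProd χ a (Finset.univ \ B) X v = 0 := by
  have hc2 : ∀ i ∈ C, ((n i).sign : ℂ) * ((n i).sign : ℂ) = 1 := by
    intro i hi
    rcases lt_or_gt_of_ne (hn0 i hi) with h | h
    · simp [Int.sign_eq_neg_one_of_neg h]
    · simp [Int.sign_eq_one_of_pos h]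
  have ha0 : ∀ i ∈ C, a i ≠ 0 := fun i hi h0 => hD (by rw [← ha i hi, h0, zero_mul])
  -- As c_i² = 1, c_B = c_C c_{C \ B}; the factors outside C do not depend on B.
  have hterm : ∀ B ∈ C.powerset.filter (fun B => Odd B.card),
      (∏ i ∈ B, ((n i).sign : ℂ)) * cothProd χ a (Finset.univ \ B) X v =
        ((∏ i ∈ C, ((n i).sign : ℂ)) * cothProd χ a (Finset.univ \ C) X v) *
          ∏ i ∈ C \ B, ((n i).sign : ℂ) * cay (exp (logArg χ a X v i)) := by
    intro B hB
    have hBC := Finset.mem_powerset.1 (Finset.mem_filter.1 hB).1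
    have h1 : Finset.univ \ B = (Finset.univ \ C) ∪ (C \ B) := by
      ext i
      have := @hBC i
      simp only [Finset.mem_sdiff, Finset.mem_univ, true_and, Finset.mem_union]
      tauto
    have h2 : Disjoint (Finset.univ \ C) (C \ B) :=
      Finset.disjoint_of_subset_right Finset.sdiff_subset Finset.sdiff_disjoint
    have h3 : (∏ i ∈ C \ B, ((n i).sign : ℂ)) * ∏ i ∈ C \ B, ((n i).sign : ℂ) = 1 := by
      rw [← Finset.prod_mul_distrib]
      exact Finset.prod_eq_one fun i hi => hc2 i (Finset.mem_sdiff.1 hi).1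
    rw [cothProd, h1, Finset.prod_union h2, ← Finset.prod_sdiff hBC, Finset.prod_mul_distrib,
      cothProd]
    linear_combination (-(∏ i ∈ B, ((n i).sign : ℂ)) *
      (∏ i ∈ Finset.univ \ C, cay (exp (logArg χ a X v i))) *
      ∏ i ∈ C \ B, cay (exp (logArg χ a X v i))) * h3
  rw [Finset.sum_congr rfl hterm, ← Finset.mul_sum, sum_odd_subsets_prod_eq_zero, mul_zero]
  have h4 : ∀ i ∈ C, ((n i).sign : ℂ) * cay (exp (logArg χ a X v i)) =
      cay (exp ((n i).sign * logArg χ a X v i)) := fun i hi => sign_mul_cay (hn0 i hi) _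
  have e1 : ∏ i ∈ C, (((n i).sign : ℂ) * cay (exp (logArg χ a X v i)) + 1) =
      ∏ i ∈ C, (cay (exp ((n i).sign * logArg χ a X v i)) + 1) :=
    Finset.prod_congr rfl fun i hi => by rw [h4 i hi]
  have e2 : ∏ i ∈ C, (((n i).sign : ℂ) * cay (exp (logArg χ a X v i)) - 1) =
      ∏ i ∈ C, (cay (exp ((n i).sign * logArg χ a X v i)) - 1) :=
    Finset.prod_congr rfl fun i hi => by rw [h4 i hi]
  rw [e1, e2]
  refine prod_cay_add_one (fun i hi => ?_) ?_
  · have h5 := exp_logArg_ne_one (ha0 i hi) v (hX i)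
    rcases lt_or_gt_of_ne (hn0 i hi) with h | h
    · rw [Int.sign_eq_neg_one_of_neg h]
      simpa [exp_neg] using h5
    · rw [Int.sign_eq_one_of_pos h]
      simpa using h5
  · rw [← exp_sum]
    -- The condition a_i |n_i| = D gives c_i / a_i = n_i / D, so these arguments sum to the circuit
    -- relation divided by D.
    have h6 : ∀ i ∈ C, ((n i).sign : ℂ) * logArg χ a X v i =
        ((n i : ℂ) * pair (χ i) X + 2 * Real.pi * I * ((n i : ℂ) * (χ i ⬝ᵥ v : ℤ))) / D := by
      intro i hi
      have h7 : (a i : ℂ) ≠ 0 := by exact_mod_cast ha0 i hi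
      have h8 : (D : ℂ) ≠ 0 := by exact_mod_cast hD
      have h9 : (a i : ℂ) * (n i : ℂ) = (n i).sign * D := by
        rw [← ha i hi]
        rw [intCast_eq_sign_mul_natAbs, Nat.cast_mul]
        ring
      rw [logArg]
      field_simp
      linear_combination (-(pair (χ i) X + 2 * Real.pi * I * (χ i ⬝ᵥ v : ℤ))) * h9
    rw [Finset.sum_congr rfl h6, ← Finset.sum_div, Finset.sum_add_distrib, ← Finset.mul_sum]
    have h10 : ∑ i ∈ C, (n i : ℂ) * pair (χ i) X = 0 := by
      simp only [← zsmul_pair, ← sum_pair]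
      rw [hn]
      simp [pair]
    have h11 : ∑ i ∈ C, (n i : ℂ) * ((χ i ⬝ᵥ v : ℤ) : ℂ) = 0 := by
      simp only [← pair_intCast, ← zsmul_pair, ← sum_pair]
      rw [hn]
      simp [pair]
    rw [h10, h11]
    simp

variable (χ) in
/-- The covering used in the definition of the forms `ω̄_{W,A}`. -/
def sepCover (A : Finset E) : Matrix (Fin d) (Fin d) ℤ :=
  Classical.epsilon fun Q : Matrix (Fin d) (Fin d) ℤ => Q.det ≠ 0 ∧ Separates χ Q A

theorem sepCover_spec [DecidableEq E] (hprim : ∀ i, IsPrimitive (χ i)) {A : Finset E}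
    (hA : LinearIndepOn ℚ (ratChar χ) (A : Set E)) :
    (sepCover χ A).det ≠ 0 ∧ Separates χ (sepCover χ A) A :=
  Classical.epsilon_spec (exists_separates hprim hA)

/-- In the counting formula the left side is positive, because v = 0 is counted. -/
theorem mult_ne_zero {A : Finset E} (hA : LinearIndepOn ℚ (ratChar χ) (A : Set E))
    (hprim : ∀ i, IsPrimitive (χ i)) : mult χ A ≠ 0 := by
  classical
  obtain ⟨hdet, hs⟩ := sepCover_spec hprim hA
  have hpos : ∀ i ∈ A, numComp χ (sepCover χ A) i ≠ 0 := fun i _ =>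
    (numComp_pos (hprim i) hdet).ne'
  have : NeZero (∏ i ∈ A, numComp χ (sepCover χ A) i) := ⟨Finset.prod_ne_zero_iff.2 hpos⟩
  have h := card_mul_prod_eq_mult (R := ∏ i ∈ A, numComp χ (sepCover χ A) i) hA
    (fun i hi => Finset.dvd_prod_of_mem _ hi) (hs.exists_dotProduct_eq hprim hdet hA)
  intro h0
  rw [h0, zero_mul, mul_eq_zero, or_iff_left (NeZero.ne _), Nat.card_eq_zero,
    or_iff_left (not_infinite_iff_finite.2 inferInstance)] at h
  exact h.elim ⟨0, fun i _ => by
    have : zlift (0 : Fin d → ZMod (∏ i ∈ A, numComp χ (sepCover χ A) i)) = 0 := by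
      ext; simp [zlift]
    rw [this, dotProduct_zero]
    exact dvd_zero _⟩

variable {p : Fin d → ℂ}

/-- A component containing L contains p, hence is the one through p: the sum over W has a single
term. -/
theorem setOf_component_superset [Fintype E] (hp : p ∈ hypInter χ Finset.univ) (A : Finset E) :
    {W | IsComponent (hypInter χ A) W ∧ connectedComponentIn (hypInter χ Finset.univ) p ⊆ W} =
      {connectedComponentIn (hypInter χ A) p} := by
  have hsub : hypInter χ Finset.univ ⊆ hypInter χ A := fun x hx =>
    mem_hypInter.2 ⟨(mem_hypInter.1 hx).1, fun i _ => (mem_hypInter.1 hx).2 i (Finset.mem_univ i)⟩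
  ext W
  constructor
  · rintro ⟨⟨q, hq, rfl⟩, hL⟩
    exact connectedComponentIn_eq (hL (mem_connectedComponentIn hp))
  · rintro rfl
    exact ⟨⟨p, hsub hp, rfl⟩, connectedComponentIn_mono p hsub⟩

variable [LinearOrder E] {R : ℕ} [NeZero R]

/-- Refinement replaces the component numbers of the covering attached to A by a family a that can
be shared by all A. -/
theorem omegaBar_apply (hprim : ∀ i, IsPrimitive (χ i)) {A : Finset E}
    (hA : LinearIndepOn ℚ (ratChar χ) (A : Set E)) (hR : (sepCover χ A).det ∣ (R : ℤ))
    {a : E → ℕ} (ha : ∀ i ∈ A, numComp χ (sepCover χ A) i ∣ a i) (haR : ∀ i ∈ A, a i ∣ R)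
    (hp : p ∈ hypInter χ A) (x : arrCompl χ) {X : Fin d → ℂ} (hX : (x : Fin d → ℂ) = p * exps X)
    (hX1 : ∀ i ∈ A, exp (pair (χ i) X) ≠ 1) :
    omegaBar χ A (connectedComponentIn (hypInter χ A) p) x =
      (((mult χ A : ℂ) * R ^ d)⁻¹ * cothSum χ a R A X) • psiProd χ A x := by
  obtain ⟨hdet, hs⟩ := sepCover_spec hprim hA
  have h1 := omegaBarVia_apply hprim hdet hA hs hR (fun i hi => (ha i hi).trans (haR i hi)) hp x hX
  choose! n hn using ha
  have h2 := cothSum_refine (R := R) (a := numComp χ (sepCover χ A)) (n := n)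
    (fun i hi => (hn i hi).symm ▸ haR i hi) (hs.exists_dotProduct_eq hprim hdet hA) hX1
  have h3 : cothSum χ (fun i => numComp χ (sepCover χ A) i * n i) R A X = cothSum χ a R A X := by
    refine Finset.sum_congr rfl fun v _ => Finset.prod_congr rfl fun i hi => ?_
    rw [logArg, logArg, hn i hi]
  rw [h2, h3] at h1
  exact h1

theorem etaBar_apply (hprim : ∀ i, IsPrimitive (χ i)) {A B : Finset E} (hAB : Disjoint A B)
    (hA : LinearIndepOn ℚ (ratChar χ) (A : Set E)) (hR : (sepCover χ A).det ∣ (R : ℤ))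
    {a : E → ℕ} (ha : ∀ i ∈ A, numComp χ (sepCover χ A) i ∣ a i) (haR : ∀ i ∈ A, a i ∣ R)
    (hp : p ∈ hypInter χ A) (x : arrCompl χ) {X : Fin d → ℂ} (hX : (x : Fin d → ℂ) = p * exps X)
    (hX1 : ∀ i ∈ A, exp (pair (χ i) X) ≠ 1) :
    etaBar χ (connectedComponentIn (hypInter χ A) p) A B x =
      (((mult χ A : ℂ) * R ^ d)⁻¹ * cothSum χ a R A X) • psiProd χ (A ∪ B) x := by
  have hg : ∀ i k, psiOne (χ i) (x : Fin d → ℂ) * psiOne (χ k) x =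
      -(psiOne (χ k) x * psiOne (χ i) x) := fun i k => psiOne_mul_psiOne _ x.2.1 _ _
  rw [etaBar, Pi.smul_apply, Pi.mul_apply, omegaBar_apply hprim hA hR ha haR hp x hX hX1,
    smul_mul_assoc, smul_comm]
  congr 1
  rw [psiProd, psiProd, psiProd, ← neg_one_pow_ell_mul hg hAB]
  rcases Nat.even_or_odd (ell A B) with h | h <;> simp [h.neg_one_pow]

end Relation

/-! ### A common refinement for all independent sets -/

section Main

open Complex

variable {E : Type*} [Fintype E] {d : ℕ} {χ : E → Fin d → ℤ}

/-- Let N be the product of all component numbers over all independent sets. Taking a_i to be N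
times the product of the |n_k|, k ∈ C \ {i}, equalises the a_i |n_i| on C, and R absorbs all a_i and
all determinants. -/
theorem exists_common_refinement [DecidableEq E] (hprim : ∀ i, IsPrimitive (χ i)) (C : Finset E)
    {n : E → ℤ} (hn0 : ∀ i ∈ C, n i ≠ 0) :
    ∃ (a : E → ℕ) (D R : ℕ), D ≠ 0 ∧ R ≠ 0 ∧ (∀ i ∈ C, a i * (n i).natAbs = D) ∧
      (∀ i, a i ∣ R) ∧ ∀ A : Finset E, LinearIndepOn ℚ (ratChar χ) (A : Set E) →
        (sepCover χ A).det ∣ (R : ℤ) ∧ ∀ i, numComp χ (sepCover χ A) i ∣ a i := by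
  classical
  set 𝒮 : Finset (Finset E) :=
    Finset.univ.filter fun A : Finset E => LinearIndepOn ℚ (ratChar χ) (A : Set E)
  set N : ℕ := ∏ A ∈ 𝒮, ∏ i, numComp χ (sepCover χ A) i with hN
  have hN0 : N ≠ 0 := Finset.prod_ne_zero_iff.2 fun A hA => Finset.prod_ne_zero_iff.2 fun i _ =>
    (numComp_pos (hprim i) (sepCover_spec hprim (Finset.mem_filter.1 hA).2).1).ne'
  set a : E → ℕ := fun i => N * ∏ k ∈ C.erase i, (n k).natAbs with ha
  have ha0 : ∀ i, a i ≠ 0 := fun i => mul_ne_zero hN0 (Finset.prod_ne_zero_iff.2 fun k hk =>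
    Int.natAbs_ne_zero.2 (hn0 k (Finset.mem_of_mem_erase hk)))
  refine ⟨a, N * ∏ k ∈ C, (n k).natAbs, (∏ i, a i) * ∏ A ∈ 𝒮, (sepCover χ A).det.natAbs,
    mul_ne_zero hN0 (Finset.prod_ne_zero_iff.2 fun k hk => Int.natAbs_ne_zero.2 (hn0 k hk)),
    mul_ne_zero (Finset.prod_ne_zero_iff.2 fun i _ => ha0 i) (Finset.prod_ne_zero_iff.2 fun A hA =>
      Int.natAbs_ne_zero.2 (sepCover_spec hprim (Finset.mem_filter.1 hA).2).1),
    fun i hi => ?_, fun i => ?_, fun A hA => ⟨?_, fun i => ?_⟩⟩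
  · rw [ha, mul_assoc, Finset.prod_erase_mul _ _ hi]
  · exact (Finset.dvd_prod_of_mem a (Finset.mem_univ i)).mul_right _
  · rw [← Int.natAbs_dvd, Int.natCast_dvd_natCast]
    exact (Finset.dvd_prod_of_mem (fun A => (sepCover χ A).det.natAbs)
      (Finset.mem_filter.2 ⟨Finset.mem_univ A, hA⟩)).mul_left _
  · refine Dvd.dvd.mul_right ?_ _
    exact (Finset.dvd_prod_of_mem (fun i => numComp χ (sepCover χ A) i) (Finset.mem_univ i)).trans
      (Finset.dvd_prod_of_mem (fun A => ∏ i, numComp χ (sepCover χ A) i)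
        (Finset.mem_filter.2 ⟨Finset.mem_univ A, hA⟩))

end Main

end ToricArr

end

theorem mainTheorem4 {E : Type*} [Fintype E] [LinearOrder E] {d : ℕ} (χ : E → Fin d → ℤ)
    (hprim : ∀ i, IsPrimitive (χ i)) (hess : IsEssential χ)
    (C : Finset E) (hC : ∀ S : Finset E, IsCircuit χ S ↔ S = C)
    (n : E → ℤ) (hn : ∑ i ∈ C, n i • χ i = 0) (hn0 : ∃ i ∈ C, n i ≠ 0)
    (L : Set (Fin d → ℂ)) (hL : IsComponent (hypInter χ Finset.univ) L) :
    ∑ j ∈ C,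
      ∑ AB : Finset E × Finset E with
          (Finset.univ \ C ⊆ AB.1 ∧ Disjoint AB.1 AB.2 ∧ j ∉ AB.1 ∪ AB.2 ∧
            AB.1 ∪ AB.2 ∪ {j} = Finset.univ ∧ Even AB.2.card),
        ∑ᶠ W ∈ {W | IsComponent (hypInter χ AB.1) W ∧ L ⊆ W},
          ((-1 : ℂ) ^ (AB.1.filter (· ≤ j)).card * (∏ i ∈ AB.2, ((n i).sign : ℂ)) *
            ((mult χ AB.1 : ℂ) / (mult χ (AB.1 ∪ AB.2) : ℂ))) • etaBar χ W AB.1 AB.2 = 0 := by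
  obtain ⟨p, hp, rfl⟩ := hL
  have hpA : ∀ A : Finset E, p ∈ hypInter χ A := fun A => mem_hypInter.2
    ⟨(mem_hypInter.1 hp).1, fun i _ => (mem_hypInter.1 hp).2 i (Finset.mem_univ i)⟩
  have hnC : ∀ j ∈ C, n j ≠ 0 := fun j hj => coeff_ne_zero hC hn hn0 hj
  have hind : ∀ {j : E} {A : Finset E}, j ∈ C → j ∉ A →
      LinearIndepOn ℚ (ratChar χ) (A : Set E) := fun hj hjA =>
    linearIndepOn_of_notMem_circuit hC hj hjA
  obtain ⟨g, m, hg, hgm⟩ := exists_mult_eq hC hn hn0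
  obtain ⟨a, D, R, hD, hR, haD, haR, hcov⟩ := exists_common_refinement hprim C hnC
  obtain ⟨k, hk, -⟩ := hn0
  have : NeZero R := ⟨hR⟩
  funext x
  obtain ⟨X, hX⟩ := exists_eq_mul_exps x.2.1 (mem_hypInter.1 hp).1
  have hX1 : ∀ i, Complex.exp (pair (χ i) X) ≠ 1 := by
    intro i h
    refine x.2.2 (Set.mem_iUnion.2 ⟨i, x.2.1, ?_⟩)
    rw [hX, chr_mul_exps, h, mul_one, (mem_hypInter.1 hp).2 i (Finset.mem_univ i)]
  have hanti : ∀ i l, psiOne (χ i) (x : Fin d → ℂ) * psiOne (χ l) x =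
      -(psiOne (χ l) x * psiOne (χ i) x) := fun i l => psiOne_mul_psiOne _ x.2.1 _ _
  set ε : ℂ := (-1 : ℂ) ^ (Finset.univ.filter (· < k)).card with hε
  -- A fixed k ∈ C serves as reference: every ψ_{E \ j} becomes a multiple of ψ_{E \ k}.
  have hpsi : ∀ j ∈ C, psiProd χ (Finset.univ \ {j}) x =
      (((n k : ℂ) * ε)⁻¹ * ((n j : ℂ) * (-1) ^ (Finset.univ.filter (· < j)).card)) •
        psiProd χ (Finset.univ \ {k}) x := by
    intro j hj
    have h1 := orderedProd_erase_relation (K := ℂ) (g := fun i => psiOne (χ i) (x : Fin d → ℂ))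
      hanti (fun i => psiOne_sq _ x.2.1 _) (n := fun i => (n i : ℂ))
      (sum_zsmul_psiOne C n χ x.2.1 hn) hj hk
    have h2 : (n k : ℂ) * ε ≠ 0 := mul_ne_zero (by exact_mod_cast hnC k hk)
      (pow_ne_zero _ (neg_ne_zero.2 one_ne_zero))
    rw [mul_smul, eq_inv_smul_iff₀ h2]
    exact h1.symm
  set τ : ℂ := ((R : ℂ) ^ d)⁻¹ * (g / m) * ((n k : ℂ) * ε)⁻¹ with hτ
  set Φ : Finset E → ℂ := fun A =>
    τ * ((∏ i ∈ Finset.univ \ A, ((n i).sign : ℂ)) * cothSum χ a R A X) with hΦ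
  have hterm : ∀ j ∈ C, ∀ AB ∈ Finset.univ.filter (fun AB : Finset E × Finset E =>
      Finset.univ \ C ⊆ AB.1 ∧ Disjoint AB.1 AB.2 ∧ j ∉ AB.1 ∪ AB.2 ∧
            AB.1 ∪ AB.2 ∪ {j} = Finset.univ ∧ Even AB.2.card),
      (∑ᶠ W ∈ {W | IsComponent (hypInter χ AB.1) W ∧
          connectedComponentIn (hypInter χ Finset.univ) p ⊆ W},
        ((-1 : ℂ) ^ (AB.1.filter (· ≤ j)).card * (∏ i ∈ AB.2, ((n i).sign : ℂ)) *
          ((mult χ AB.1 : ℂ) / (mult χ (AB.1 ∪ AB.2) : ℂ))) • etaBar χ W AB.1 AB.2) x =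
      ((-1 : ℂ) ^ (AB.1.filter (· ≤ j)).card * (-1) ^ (Finset.univ.filter (· < j)).card *
        Φ AB.1) • psiProd χ (Finset.univ \ {k}) x := by
    rintro j hj ⟨A, B⟩ hAB
    obtain ⟨-, hdisj, hjn, hun, -⟩ := (Finset.mem_filter.1 hAB).2
    dsimp only at hdisj hjn hun ⊢
    have hjA : j ∉ A := fun h => hjn (Finset.mem_union_left _ h)
    have hjB : j ∉ B := fun h => hjn (Finset.mem_union_right _ h)
    have hU : A ∪ B = Finset.univ \ {j} := by
      ext i
      have h1 := Finset.ext_iff.1 hun i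
      simp only [Finset.mem_union, Finset.mem_singleton, Finset.mem_univ, iff_true] at h1
      simp only [Finset.mem_union, Finset.mem_sdiff, Finset.mem_univ, true_and,
        Finset.mem_singleton]
      refine ⟨?_, fun h => h1.resolve_right h⟩
      rintro h rfl
      exact h.elim hjA hjB
    have hB : Finset.univ \ A = insert j B := by
      ext i
      have h1 := Finset.ext_iff.1 hun i
      have h2 : i ∈ A → i ∉ B := fun h => Finset.disjoint_left.1 hdisj h
      simp only [Finset.mem_union, Finset.mem_singleton, Finset.mem_univ, iff_true] at h1
      simp only [Finset.mem_sdiff, Finset.mem_univ, true_and, Finset.mem_insert]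
      refine ⟨by tauto, ?_⟩
      rintro (rfl | h)
      · exact hjA
      · exact fun h' => h2 h' h
    have hAi := hind hj hjA
    have hmA : (mult χ A : ℂ) ≠ 0 := by exact_mod_cast mult_ne_zero hAi hprim
    have hmj : (mult χ (Finset.univ \ {j}) : ℂ) ≠ 0 := by
      exact_mod_cast mult_ne_zero (hind hj (by simp)) hprim
    have hgC : (g : ℂ) ≠ 0 := by exact_mod_cast hg.ne'
    have hgm' : (g : ℂ) * mult χ (Finset.univ \ {j}) = (n j).natAbs * m := by
      exact_mod_cast hgm j hj
    have hmC : (m : ℂ) ≠ 0 := by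
      intro h0
      rw [h0, mul_zero] at hgm'
      exact mul_ne_zero hgC hmj hgm'
    rw [setOf_component_superset hp, finsum_mem_singleton, Pi.smul_apply,
      etaBar_apply hprim hdisj hAi (hcov A hAi).1 (fun i _ => (hcov A hAi).2 i)
        (fun i _ => haR i) (hpA A) x hX (fun i _ => hX1 i), hU, hpsi j hj, smul_smul, smul_smul]
    congr 1
    rw [hΦ]
    dsimp only
    rw [hB, Finset.prod_insert hjB, hτ]
    -- Here |n_j| cancels and only c_j survives, which completes c_B to the sign product over E \ A
    -- = B ∪ {j}.
    have hkey : (n j : ℂ) / mult χ (Finset.univ \ {j}) = (n j).sign * (g / m) := by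
      rw [intCast_eq_sign_mul_natAbs (n j), div_eq_iff hmj]
      field_simp
      linear_combination (-((n j).sign : ℂ)) * hgm'
    have hmul : (mult χ A : ℂ) / mult χ (Finset.univ \ {j}) *
        (((mult χ A : ℂ) * R ^ d)⁻¹ * (n j : ℂ)) = ((R : ℂ) ^ d)⁻¹ * ((n j).sign * (g / m)) := by
      rw [← hkey, mul_inv]
      field_simp
    linear_combination ((-1 : ℂ) ^ (A.filter (· ≤ j)).card * (∏ i ∈ B, ((n i).sign : ℂ)) *
      cothSum χ a R A X * ((n k : ℂ) * ε)⁻¹ * (-1) ^ (Finset.univ.filter (· < j)).card) * hmul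
  rw [Finset.sum_apply]
  simp only [Finset.sum_apply]
  rw [Finset.sum_congr rfl fun j hj => Finset.sum_congr rfl (hterm j hj)]
  simp only [← Finset.sum_smul]
  rw [sum_partitions_eq_sum_odd, hΦ, ← Finset.mul_sum]
  simp only [Finset.sdiff_sdiff_eq_self (Finset.subset_univ _), cothSum, Finset.mul_sum]
  -- After exchanging the sums, the relation already holds for each cocharacter v separately.
  rw [Finset.sum_comm, Finset.sum_eq_zero, zero_smul, Pi.zero_apply]
  intro v _
  rw [← Finset.mul_sum, sum_odd_sign_cothProd_eq_zero hn hnC hD haD hX1, mul_zero]
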